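/- Let $\Phi$ be a homogeneous Poisson point process of intensity $\lambda>0$ in $\mathbb R^2$. The Voronoi cell of $X\in\Phi$ is $\mathcal V_X=\{x:\|x-X\|\le\|x-Y\|\text{ for all }Y\in\Phi\setminus\{X\}\}$; two distinct points $X,Y\in\Phi$ are Delaunay neighbours if $\mathcal V_X\cap\mathcal V_Y$ is a nondegenerate segment (possibly unbounded), which is then called a Voronoi edge. Points of the plane are ordered by their first coordinate (ties broken by the second one). Let $$L=\{p(-\sin\varphi,\cos\varphi)+s(\cos\varphi,\sin\varphi):s\in\mathbb R\}$$ be a line whose orientation $\varphi$ and signed distance $p$ to the origin are random variables with any joint law (possibly deterministic), with $(\varphi,p)$ independent of $\Phi$. Let $\Upsilon\subset\mathbb R$ be the set of the coordinates $s$ of the points of $L$ that lie on a Voronoi edge. For $Z\in\Upsilon$ let $X_1(Z)<X_2(Z)$ be the two Delaunay neighbours of the edge that contains the corresponding point $z$ of $L$, and let $\Theta(Z)\in(0,2\pi)$ be the clockwise angle from $X_1(Z)-z$ to $X_2(Z)-z$. Almost surely, every point of $\Upsilon$ lies on exactly one Voronoi edge, so that $\Theta(Z)$ is well defined. The intensity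 $\mu=\mathbb E[\#(\Upsilon\cap[0,1])]$ is positive and finite, and the Palm distribution $\mathbb P^0_\Upsilon(\Theta\in\cdot)$ of the mark $\Theta$ with respect to $\Upsilon$, that is, the probability measure on $\mathbb R$ such that for all Borel sets $I,B\subset\mathbb R$ $$\mathbb E\big[\#\{Z\in\Upsilon\cap I:\Theta(Z)\in B\}\big]=\mu\,|I|\;\mathbb P^0_\Upsilon(\Theta\in B),$$ exists and has the density $$f_\Theta(t)=\tfrac14\sin\tfrac t2,\qquad 0<t<2\pi .$$ In particular $\mathbb P^0_\Upsilon(\Theta\in(t,\pi))=\tfrac12\cos\tfrac t2$ for all $t\in(0,\pi)$. -/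

import Mathlib

open MeasureTheory ProbabilityTheory Set
open scoped ENNReal

/-! The Euclidean plane is `ℂ`, with its Euclidean distance and Lebesgue measure `volume`. -/

/-- The number (possibly infinite) of points of the configuration `S` that lie in `B`. -/
noncomputable def pointCount {α : Type*} (S B : Set α) : ℝ≥0∞ := ((S ∩ B).encard : ℝ≥0∞)

/-- The σ-algebra on planar configurations generated by the counts in all Borel sets. -/
@[reducible] noncomputable def configSigma : MeasurableSpace (Set ℂ) :=
  ⨆ B : {B : Set ℂ // MeasurableSet B},
    MeasurableSpace.comap (fun S : Set ℂ => pointCount S B.1) inferInstance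

/-- `Φ` is a homogeneous Poisson point process of intensity `lam` in the plane: the counts are
random variables, the count in a Borel set `B` of finite area is Poisson with mean `lam * |B|`, and
the counts in finitely many disjoint Borel sets are independent. -/
structure IsPoissonProcess {Ω : Type*} [MeasurableSpace Ω] (P : Measure Ω) (lam : ℝ)
    (Φ : Ω → Set ℂ) : Prop where
  measurable_process : Measurable[_, configSigma] Φ
  law_count : ∀ B : Set ℂ, MeasurableSet B → volume B ≠ ∞ → ∀ k : ℕ,
    P {ω | pointCount (Φ ω) B = (k : ℝ≥0∞)} =
      ENNReal.ofReal (Real.exp (-(lam * (volume B).toReal)) *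
        (lam * (volume B).toReal) ^ k / (k.factorial : ℝ))
  indep_count : ∀ (n : ℕ) (B : Fin n → Set ℂ), (∀ i, MeasurableSet (B i)) →
    Pairwise (fun i j => Disjoint (B i) (B j)) →
    iIndepFun (fun i ω => pointCount (Φ ω) (B i)) P

/-- The Voronoi cell of the nucleus `X` in the configuration `S`. -/
def voronoiCell (S : Set ℂ) (X : ℂ) : Set ℂ :=
  {x | ∀ Y ∈ S, Y ≠ X → dist x X ≤ dist x Y}

/-- The set shared by the cells of `X` and `Y`. -/
def voronoiFacet (S : Set ℂ) (X Y : ℂ) : Set ℂ := voronoiCell S X ∩ voronoiCell S Y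

/-- `X` and `Y` are Delaunay neighbours: distinct nuclei whose cells share a boundary segment. The
shared set is a convex subset of the bisector of `X` and `Y`, so it is a nondegenerate segment
(or half-line, or line) as soon as it has two points. -/
def IsDelaunayPair (S : Set ℂ) (X Y : ℂ) : Prop :=
  X ∈ S ∧ Y ∈ S ∧ X ≠ Y ∧ (voronoiFacet S X Y).Nontrivial

/-- The order of the plane by the first coordinate (ties are broken by the second one). -/
def planeLt (X Y : ℂ) : Prop := X.re < Y.re ∨ (X.re = Y.re ∧ X.im < Y.im)

/-- `X < Y` are the ordered Delaunay neighbours of a Voronoi edge that contains `z`. -/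
def IsOrderedNeighbours (S : Set ℂ) (z X Y : ℂ) : Prop :=
  planeLt X Y ∧ IsDelaunayPair S X Y ∧ z ∈ voronoiFacet S X Y

/-- The angle in `[0, 2π)` from `D` to `D'` seen from `Z`, measured clockwise. -/
noncomputable def clockwiseAngle (D Z D' : ℂ) : ℝ :=
  toIcoMod Real.two_pi_pos 0 (Complex.arg ((D - Z) / (D' - Z)))

/-- The point with coordinate `s` on the line with direction angle `φ` and signed distance `p` to
the origin. -/
noncomputable def linePoint (φ p s : ℝ) : ℂ :=
  ((p : ℂ) * Complex.I + (s : ℂ)) * Complex.exp ((φ : ℂ) * Complex.I)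

/-- The coordinates along the line of its crossings with the Voronoi edges. -/
def crossings (S : Set ℂ) (φ p : ℝ) : Set ℝ :=
  {s | ∃ X Y : ℂ, IsDelaunayPair S X Y ∧ linePoint φ p s ∈ voronoiFacet S X Y}

/-- The crossings, marked by the angle under which they see their ordered Delaunay neighbours. -/
noncomputable def markedCrossings (S : Set ℂ) (φ p : ℝ) : Set (ℝ × ℝ) :=
  {q | ∃ X Y : ℂ, IsOrderedNeighbours S (linePoint φ p q.1) X Y ∧
    q.2 = clockwiseAngle X (linePoint φ p q.1) Y}

/-- The intensity of a marked point process on the real line (first coordinate: position, second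
coordinate: mark): the mean number of its points with position in `[0, 1]`. -/
noncomputable def markedIntensity {Ω : Type*} [MeasurableSpace Ω] (P : Measure Ω)
    (M : Ω → Set (ℝ × ℝ)) : ℝ≥0∞ :=
  ∫⁻ ω, pointCount (M ω) (Icc 0 1 ×ˢ univ) ∂P

/-- `ν` is the Palm distribution of the mark of the marked point process `M` on the real line: `M`
has positive finite intensity `μ`, and, for all Borel sets `I` and `B`, the mean number of points
with position in `I` and mark in `B` is `μ |I| ν(B)`. -/
structure HasPalmMarkDistribution {Ω : Type*} [MeasurableSpace Ω] (P : Measure Ω)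
    (M : Ω → Set (ℝ × ℝ)) (ν : Measure ℝ) : Prop where
  aemeasurable_count : ∀ I B : Set ℝ, MeasurableSet I → MeasurableSet B →
    AEMeasurable (fun ω => pointCount (M ω) (I ×ˢ B)) P
  intensity_pos : 0 < markedIntensity P M
  intensity_lt_top : markedIntensity P M < ∞
  prob : IsProbabilityMeasure ν
  mean_count : ∀ I B : Set ℝ, MeasurableSet I → MeasurableSet B →
    ∫⁻ ω, pointCount (M ω) (I ×ˢ B) ∂P = markedIntensity P M * volume I * ν B

/-- The probability law on the line with density `(1/4) sin (t/2)` on `(0, 2π)`. -/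
noncomputable def angleLaw : Measure ℝ :=
  (volume.restrict (Ioo 0 (2 * Real.pi))).withDensity
    (fun t => ENNReal.ofReal (1 / 4 * Real.sin (t / 2)))

/-! Almost surely, a crossing of `L` with a Voronoi edge is the point z of `L` equidistant from two
nuclei X, Y such that no nucleus is nearer to z, that is, such that the open disc about z through X
and Y is empty. Counting marked crossings thus becomes a sum over pairs of nuclei
(`InGeneralPosition.pointCount_eq_pairSum`). Mecke's formula, applied twice, turns its mean into λ²
times an integral over pairs (x, y) of exp(-λπR²), where R is the radius of the disc.

The integral is computed in the coordinates of `lintegral_pair_eq_bisector`: the coordinate s of z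
on the line, the direction γ of y - x, and a complex number w in the upper half-plane with x = z + i
e^{iγ} w and y = z + i e^{iγ} conj w. The Jacobian is |2 cos(γ - φ)| · 2 Im w. Everything
factorises: the position is s, the order of the pair depends on γ only, R = |w|, and the mark is the
clockwise angle from w to conj w, which is 2 arg w. With w = r e^{iα}, the mark t = 2α receives the
weight sin α dα, which normalises to (1/4) sin(t/2) dt. The line and λ enter only through constants,
so the law of the line affects the intensity and not the Palm distribution.

Mecke's formula is proved by testing both sides on products of a Borel set with a void event. These
generate the σ-algebra (`configSigma_eq_generateFrom`), are stable under intersection, and give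
explicit Poisson expressions (`IsPoissonProcess.lintegral_removal_voidBox`). The same formula for
pairs and triples yields general position (`IsPoissonProcess.ae_inGeneralPosition`): for each fixed
line the degenerate pairs and triples form Lebesgue null sets, and independence carries this over to
the random line. -/

open scoped ComplexConjugate

/-! ### Void events generate the σ-algebra of configurations -/

/-- The space of planar configurations, with the σ-algebra generated by the counts. -/
abbrev Config : Type := Set ℂ

attribute [local instance] configSigma

lemma measurable_pointCount {B : Set ℂ} (hB : MeasurableSet B) :
    Measurable (fun S : Config => pointCount S B) := by
  refine Measurable.mono (comap_measurable _) ?_ le_rfl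
  exact le_iSup (fun B : {B : Set ℂ // MeasurableSet B} =>
    MeasurableSpace.comap (fun S : Set ℂ => pointCount S B.1) inferInstance) ⟨B, hB⟩

lemma pointCount_eq_zero {α : Type*} {S B : Set α} : pointCount S B = 0 ↔ Disjoint S B := by
  simp [pointCount, Set.disjoint_iff_inter_eq_empty]

/-- The configurations without points in `C`. -/
def voidEvent (C : Set ℂ) : Set Config := {S | Disjoint S C}

lemma measurableSet_voidEvent {C : Set ℂ} (hC : MeasurableSet C) :
    MeasurableSet (voidEvent C) := by
  have : voidEvent C = (fun S : Config => pointCount S C) ⁻¹' {0} := by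
    ext S; exact pointCount_eq_zero.symm
  rw [this]; exact measurable_pointCount hC (measurableSet_singleton 0)

/-- The void events of Borel sets of finite area. -/
def voidEvents : Set (Set Config) :=
  {E | ∃ C : Set ℂ, MeasurableSet C ∧ volume C ≠ ∞ ∧ E = voidEvent C}

lemma isPiSystem_voidEvents : IsPiSystem voidEvents := by
  rintro _ ⟨C, hC, hC', rfl⟩ _ ⟨D, hD, hD', rfl⟩ -
  refine ⟨C ∪ D, hC.union hD, ?_, ?_⟩
  · exact ((measure_union_le C D).trans_lt
      (ENNReal.add_lt_top.2 ⟨hC'.lt_top, hD'.lt_top⟩)).ne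
  · ext S; exact Set.disjoint_union_right.symm

/-- The index of the cell of the square grid of mesh `1 / n` that contains `z`. -/
noncomputable def gridIndex (n : ℕ) (z : ℂ) : ℤ × ℤ := (⌊n * z.re⌋, ⌊n * z.im⌋)

lemma measurable_gridIndex (n : ℕ) : Measurable (gridIndex n) := by
  unfold gridIndex; fun_prop

lemma eventually_floor_ne {a b : ℝ} (h : a ≠ b) :
    ∀ᶠ n : ℕ in Filter.atTop, ⌊(n : ℝ) * a⌋ ≠ ⌊(n : ℝ) * b⌋ := by
  have hpos : 0 < |a - b| := abs_pos.2 (sub_ne_zero.2 h)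
  -- Numbers with the same floor differ by less than 1, whereas n |a - b| ≥ 1 from this threshold
  -- on.
  filter_upwards [Filter.eventually_ge_atTop ⌈1 / |a - b|⌉₊] with n hn hfl
  have h1 := Int.abs_sub_lt_one_of_floor_eq_floor hfl
  rw [← mul_sub, abs_mul, Nat.abs_cast] at h1
  have h2 : 1 / |a - b| ≤ n := (Nat.le_ceil _).trans (by exact_mod_cast hn)
  rw [div_le_iff₀ hpos] at h2
  linarith

lemma eventually_gridIndex_ne {z w : ℂ} (h : z ≠ w) :
    ∀ᶠ n : ℕ in Filter.atTop, gridIndex n z ≠ gridIndex n w := by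
  have : z.re ≠ w.re ∨ z.im ≠ w.im := by
    by_contra! h'; exact h (Complex.ext h'.1 h'.2)
  rcases this with h' | h'
  · filter_upwards [eventually_floor_ne h'] with n hn heq
    exact hn (congrArg Prod.fst heq)
  · filter_upwards [eventually_floor_ne h'] with n hn heq
    exact hn (congrArg Prod.snd heq)

lemma eventually_injOn_gridIndex {F : Set ℂ} (hF : F.Finite) :
    ∀ᶠ n : ℕ in Filter.atTop, InjOn (gridIndex n) F := by
  have : ∀ᶠ n : ℕ in Filter.atTop, ∀ z ∈ F, ∀ w ∈ F, z ≠ w → gridIndex n z ≠ gridIndex n w := by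
    refine (Filter.eventually_all_finite hF).2 fun z _ =>
      (Filter.eventually_all_finite hF).2 fun w _ => ?_
    by_cases h : z = w
    · simp [h]
    · filter_upwards [eventually_gridIndex_ne h] with n hn _ using hn
  filter_upwards [this] with n hn z hz w hw heq
  by_contra hne
  exact hn z hz w hw hne heq

/-- Fine grids separate the points of a finite set, and an infinite set has finite subsets of every
size. Counting is thereby reduced to asking which grid cells are occupied. -/
lemma encard_eq_iSup_gridIndex (A : Set ℂ) :
    (A.encard : ℝ≥0∞) = ⨆ n : ℕ, ((gridIndex n '' A).encard : ℝ≥0∞) := by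
  apply le_antisymm
  · have key : ∀ F : Set ℂ, F ⊆ A → F.Finite →
        (F.encard : ℝ≥0∞) ≤ ⨆ n : ℕ, ((gridIndex n '' A).encard : ℝ≥0∞) := by
      intro F hFA hF
      obtain ⟨n, hn⟩ := (eventually_injOn_gridIndex hF).exists
      refine le_trans ?_ (le_iSup _ n)
      rw [← hn.encard_image]
      exact ENat.toENNReal_le.2 (encard_le_encard (image_mono hFA))
    by_cases hA : A.Finite
    · exact key A subset_rfl hA
    · rw [Set.not_finite.1 hA |>.encard_eq]
      rw [ENat.toENNReal_top, ← ENNReal.iSup_natCast]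
      refine iSup_le fun m => ?_
      obtain ⟨F, hFA, hF⟩ := exists_subset_encard_eq (s := A) (k := (m : ℕ∞))
        (by rw [(Set.not_finite.1 hA).encard_eq]; exact le_top)
      have := key F hFA (finite_of_encard_eq_coe hF)
      rwa [hF] at this
  · exact iSup_le fun n => ENat.toENNReal_le.2 (encard_image_le _ _)

open Classical in
lemma encard_eq_tsum {α : Type*} (A : Set α) :
    (A.encard : ℝ≥0∞) = ∑' x : α, if x ∈ A then 1 else 0 := by
  rw [← ENNReal.tsum_set_one, tsum_subtype A (fun _ => (1 : ℝ≥0∞))]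
  rfl

/-- The annulus of the points whose norm has integer part `k`. -/
def annulus (k : ℕ) : Set ℂ := {z | ⌊‖z‖⌋₊ = k}

lemma measurableSet_annulus (k : ℕ) : MeasurableSet (annulus k) :=
  (show Measurable fun z : ℂ => ⌊‖z‖⌋₊ by fun_prop) (measurableSet_singleton k)

lemma volume_annulus_ne_top (k : ℕ) : volume (annulus k) ≠ ∞ := by
  refine ne_top_of_le_ne_top (measure_closedBall_lt_top (x := (0 : ℂ)) (r := k + 1)).ne
    (measure_mono fun z hz => ?_)
  have : ‖z‖ < ⌊‖z‖⌋₊ + 1 := Nat.lt_floor_add_one _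
  rw [show ⌊‖z‖⌋₊ = k from hz] at this
  simpa using this.le

open Classical in
-- The count is a supremum over grids of numbers of occupied cells, each of which is decided by a
-- void event. The source is an arbitrary measurable space so that the lemma applies to the
-- σ-algebra generated by the void events themselves.
lemma measurable_pointCount_of_disjoint {α : Type*} [MeasurableSpace α] (F : α → Set ℂ)
    (h : ∀ C : Set ℂ, MeasurableSet C → volume C ≠ ∞ → MeasurableSet {a | Disjoint (F a) C})
    {B : Set ℂ} (hB : MeasurableSet B) : Measurable (fun a => pointCount (F a) B) := by
  -- Cutting along annuli removes the restriction to finite area.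
  have hvoid : ∀ C : Set ℂ, MeasurableSet C → MeasurableSet {a | Disjoint (F a) C} := by
    intro C hC
    have : {a | Disjoint (F a) C} = ⋂ k : ℕ, {a | Disjoint (F a) (C ∩ annulus k)} := by
      ext a
      simp only [Set.mem_iInter, Set.mem_ofPred_eq]
      refine ⟨fun h k => h.mono_right inter_subset_left, fun h => ?_⟩
      rw [Set.disjoint_left]
      intro z hz hzC
      exact Set.disjoint_left.1 (h ⌊‖z‖⌋₊) hz ⟨hzC, rfl⟩
    rw [this]
    exact MeasurableSet.iInter fun k => h _ (hC.inter (measurableSet_annulus k))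
      (ne_top_of_le_ne_top (volume_annulus_ne_top k) (measure_mono inter_subset_right))
  have heq : (fun a => pointCount (F a) B) = fun a => ⨆ n : ℕ, ∑' k : ℤ × ℤ,
      if a ∈ {a | Disjoint (F a) (B ∩ gridIndex n ⁻¹' {k})} then (0 : ℝ≥0∞) else 1 := by
    funext a
    rw [pointCount, encard_eq_iSup_gridIndex]
    refine iSup_congr fun n => ?_
    rw [encard_eq_tsum]
    refine tsum_congr fun k => ?_
    have : k ∈ gridIndex n '' (F a ∩ B) ↔
        ¬ a ∈ {a | Disjoint (F a) (B ∩ gridIndex n ⁻¹' {k})} := by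
      rw [mem_ofPred_eq, Set.not_disjoint_iff]
      constructor
      · rintro ⟨z, ⟨h1, h2⟩, h3⟩; exact ⟨z, h1, h2, h3⟩
      · rintro ⟨z, h1, h2, h3⟩; exact ⟨z, ⟨h1, h2⟩, h3⟩
    by_cases h : k ∈ gridIndex n '' (F a ∩ B)
    · rw [if_pos h, if_neg (this.1 h)]
    · rw [if_neg h, if_pos (by_contra fun h' => h (this.2 h'))]
  rw [heq]
  exact Measurable.iSup fun n => Measurable.tsum fun k => Measurable.ite
    (hvoid _ (hB.inter (measurable_gridIndex n (measurableSet_singleton k))))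
    measurable_const measurable_const

lemma configSigma_eq_generateFrom : configSigma = MeasurableSpace.generateFrom voidEvents := by
  apply le_antisymm
  · refine iSup_le fun B => Measurable.comap_le ?_
    exact @measurable_pointCount_of_disjoint _ (MeasurableSpace.generateFrom voidEvents) id
      (fun C hC hC' => MeasurableSpace.measurableSet_generateFrom ⟨C, hC, hC', rfl⟩) _ B.2
  · refine MeasurableSpace.generateFrom_le ?_
    rintro _ ⟨C, hC, -, rfl⟩
    exact measurableSet_voidEvent hC

open Classical in
lemma pointCount_eq_tsum {α : Type*} (S B : Set α) :
    pointCount S B = ∑' x : α, if x ∈ S ∧ x ∈ B then 1 else 0 := by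
  rw [pointCount, encard_eq_tsum]
  refine tsum_congr fun x => ?_
  split_ifs with h h' h' <;> first | rfl | exact absurd h h' | exact absurd h' h

/-! ### The kernel that removes one point -/

open Classical in
-- Removing a point outside `C` does not affect whether `C` is void; removing a point of `C` empties
-- `C` exactly when it was the only point there. The two terms on the right are these two cases.
lemma tsum_removal_indicator (S A C : Set ℂ) :
    (∑' x : ℂ, if x ∈ S ∧ x ∈ A ∧ Disjoint (S \ {x}) C then (1 : ℝ≥0∞) else 0) =
      (if pointCount S C = 0 then pointCount S (A \ C) else 0) +
      (if pointCount S C = 1 then pointCount S (A ∩ C) else 0) := by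
  have h1 : pointCount S C = 1 ↔ ∃ y, S ∩ C = {y} := by
    rw [pointCount, ← ENat.toENNReal_one, ENat.toENNReal_inj, encard_eq_one]
  have h0 : ∀ x, x ∉ C → (Disjoint (S \ {x}) C ↔ Disjoint S C) := by
    intro x hx
    refine ⟨fun h => Set.disjoint_left.2 fun z hz hzC => ?_, fun h => h.mono_left sdiff_subset⟩
    exact Set.disjoint_left.1 h ⟨hz, fun hzx => hx (hzx ▸ hzC)⟩ hzC
  have h2 : ∀ x ∈ S, x ∈ C → (Disjoint (S \ {x}) C ↔ pointCount S C = 1) := by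
    intro x hxS hx
    rw [h1]
    constructor
    · intro h
      refine ⟨x, Set.eq_singleton_iff_unique_mem.2 ⟨⟨hxS, hx⟩, fun z hz => ?_⟩⟩
      by_contra hne
      exact Set.disjoint_left.1 h ⟨hz.1, hne⟩ hz.2
    · rintro ⟨y, hy⟩
      have hxy : x = y := by
        have : x ∈ S ∩ C := ⟨hxS, hx⟩
        rwa [hy] at this
      refine Set.disjoint_left.2 fun z hz hzC => hz.2 ?_
      have : z ∈ S ∩ C := ⟨hz.1, hzC⟩
      rw [hy] at this
      rw [hxy]; exact this
  have e1 : (if pointCount S C = 0 then pointCount S (A \ C) else 0) =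
      ∑' x : ℂ, if x ∈ S ∧ x ∈ A \ C ∧ Disjoint S C then (1 : ℝ≥0∞) else 0 := by
    simp only [pointCount_eq_zero]
    split_ifs with h
    · simp [pointCount_eq_tsum, h]
    · simp [h]
  have e2 : (if pointCount S C = 1 then pointCount S (A ∩ C) else 0) =
      ∑' x : ℂ, if x ∈ S ∧ x ∈ A ∩ C ∧ pointCount S C = 1 then (1 : ℝ≥0∞) else 0 := by
    split_ifs with h
    · rw [pointCount_eq_tsum]; simp [h]
    · simp [h]
  rw [e1, e2, ← ENNReal.tsum_add]
  refine tsum_congr fun x => ?_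
  by_cases hS : x ∈ S
  · by_cases hC : x ∈ C
    · simp [hS, hC, h2 x hS hC]
    · simp [hS, hC, h0 x hC]
  · simp [hS]

open Classical in
/-- The sum, over the points `x` of a configuration `S` in the annulus `k`, of the Dirac masses at
`(x, S \ {x})`, for the configurations with exactly `m` points in this annulus. -/
noncomputable def removalMeasure (k m : ℕ) (S : Config) : Measure (ℂ × Config) :=
  Measure.sum fun x : ℂ => if x ∈ S ∧ x ∈ annulus k ∧ pointCount S (annulus k) = m then
    Measure.dirac (x, (S \ {x} : Set ℂ)) else 0

open Classical in
lemma lintegral_removalMeasure (k m : ℕ) (S : Config) {f : ℂ × Config → ℝ≥0∞}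
    (hf : Measurable f) :
    ∫⁻ q, f q ∂removalMeasure k m S =
      ∑' x : ℂ, if x ∈ S ∧ x ∈ annulus k ∧ pointCount S (annulus k) = m then
        f (x, (S \ {x} : Set ℂ)) else 0 := by
  rw [removalMeasure, lintegral_sum_measure]
  refine tsum_congr fun x => ?_
  split_ifs
  · rw [lintegral_dirac' _ hf]
  · simp

open Classical in
lemma removalMeasure_apply (k m : ℕ) (S : Config) {E : Set (ℂ × Config)} (hE : MeasurableSet E) :
    removalMeasure k m S E = ∑' x : ℂ, if (x ∈ S ∧ x ∈ annulus k ∧ pointCount S (annulus k) = m) ∧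
        (x, (S \ {x} : Set ℂ)) ∈ E then 1 else 0 := by
  rw [← lintegral_indicator_one hE, lintegral_removalMeasure _ _ _ (measurable_one.indicator hE)]
  refine tsum_congr fun x => ?_
  by_cases h : (x, (S \ {x} : Set ℂ)) ∈ E <;> simp [h]

/-- This bound is the reason for fixing an annulus and its count: finite pieces are needed for the
π-system argument of measurability, and they make their sum an s-finite kernel. -/
lemma removalMeasure_univ_le (k m : ℕ) (S : Config) : removalMeasure k m S univ ≤ m := by
  classical
  rw [removalMeasure_apply _ _ _ MeasurableSet.univ]
  by_cases h : pointCount S (annulus k) = m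
  · rw [← h, pointCount_eq_tsum]
    refine ENNReal.tsum_le_tsum fun x => ?_
    simp
  · simp [h]

instance (k m : ℕ) (S : Config) : IsFiniteMeasure (removalMeasure k m S) :=
  ⟨(removalMeasure_univ_le k m S).trans_lt (ENNReal.natCast_lt_top m)⟩

/-- The products of a Borel set with a void event. -/
def voidBoxes : Set (Set (ℂ × Config)) :=
  image2 (· ×ˢ ·) {A : Set ℂ | MeasurableSet A} voidEvents

lemma voidEvent_empty : voidEvent ∅ = univ := by
  ext S; simp [voidEvent]

lemma univ_mem_voidEvents : (univ : Set Config) ∈ voidEvents :=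
  ⟨∅, MeasurableSet.empty, by simp, voidEvent_empty.symm⟩

lemma isPiSystem_voidBoxes : IsPiSystem voidBoxes :=
  MeasurableSpace.isPiSystem_measurableSet.prod isPiSystem_voidEvents

lemma generateFrom_voidBoxes :
    (inferInstance : MeasurableSpace (ℂ × Config)) = MeasurableSpace.generateFrom voidBoxes :=
  (generateFrom_eq_prod MeasurableSpace.generateFrom_measurableSet
    configSigma_eq_generateFrom.symm isCountablySpanning_measurableSet
    ⟨fun _ => univ, fun _ => univ_mem_voidEvents, iUnion_const _⟩).symm

lemma removalMeasure_voidBox (k m : ℕ) (S : Config) {A C : Set ℂ} (hA : MeasurableSet A)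
    (hC : MeasurableSet C) [Decidable (pointCount S (annulus k) = m)]
    [Decidable (pointCount S C = 0)] [Decidable (pointCount S C = 1)] :
    removalMeasure k m S (A ×ˢ voidEvent C) = if pointCount S (annulus k) = m then
      (if pointCount S C = 0 then pointCount S ((annulus k ∩ A) \ C) else 0) +
      (if pointCount S C = 1 then pointCount S ((annulus k ∩ A) ∩ C) else 0) else 0 := by
  classical
  rw [removalMeasure_apply _ _ _ (hA.prod (measurableSet_voidEvent hC))]
  split_ifs with h
  all_goals try simp [h]
  all_goals
    have := tsum_removal_indicator S (annulus k ∩ A) C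
    simp_all [voidEvent, and_assoc]

/-- On products of a Borel set with a void event the mass is an expression in finitely many counts,
and such products form a generating π-system. -/
lemma measurable_removalMeasure (k m : ℕ) : Measurable (removalMeasure k m) := by
  classical
  have hbox : ∀ E ∈ voidBoxes, Measurable fun S => removalMeasure k m S E := by
    rintro _ ⟨A, hA, _, ⟨C, hC, -, rfl⟩, rfl⟩
    simp only [removalMeasure_voidBox k m _ hA hC]
    have hcount : ∀ (B : Set ℂ) (c : ℝ≥0∞), MeasurableSet B →
        MeasurableSet {S : Config | pointCount S B = c} := fun B c hB =>
      measurable_pointCount hB (measurableSet_singleton c)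
    refine Measurable.ite (hcount _ _ (measurableSet_annulus k)) (Measurable.add ?_ ?_)
      measurable_const
    · exact Measurable.ite (hcount _ _ hC)
        (measurable_pointCount (((measurableSet_annulus k).inter hA).diff hC)) measurable_const
    · exact Measurable.ite (hcount _ _ hC)
        (measurable_pointCount (((measurableSet_annulus k).inter hA).inter hC)) measurable_const
  refine Measurable.measure_of_isPiSystem generateFrom_voidBoxes isPiSystem_voidBoxes hbox ?_
  exact hbox univ ⟨univ, MeasurableSet.univ (α := ℂ), univ, univ_mem_voidEvents, univ_prod_univ⟩

/-- The kernel that maps a locally finite configuration `S` to the sum, over its points `x`, of the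
Dirac masses at `(x, S \ {x})`. -/
noncomputable def removalKernel : Kernel Config (ℂ × Config) :=
  Kernel.sum fun i : ℕ × ℕ => ⟨removalMeasure i.1 i.2, measurable_removalMeasure i.1 i.2⟩

instance : IsSFiniteKernel removalKernel := by
  have (i : ℕ × ℕ) : IsFiniteKernel (⟨removalMeasure i.1 i.2, measurable_removalMeasure i.1 i.2⟩ :
      Kernel Config (ℂ × Config)) :=
    ⟨i.2, ENNReal.natCast_lt_top _, fun S => removalMeasure_univ_le _ _ S⟩
  exact Kernel.isSFiniteKernel_sum

/-- A configuration with finitely many points in each bounded set. -/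
def IsLocallyFinite (S : Set ℂ) : Prop := ∀ k, (S ∩ annulus k).Finite

lemma IsLocallyFinite.mono {S T : Set ℂ} (hS : IsLocallyFinite S) (h : T ⊆ S) :
    IsLocallyFinite T := fun k => (hS k).subset (inter_subset_inter_left _ h)

open Classical in
lemma lintegral_removalKernel {S : Config} (hS : IsLocallyFinite S) {f : ℂ × Config → ℝ≥0∞}
    (hf : Measurable f) :
    ∫⁻ q, f q ∂removalKernel S = ∑' x : ℂ, if x ∈ S then f (x, (S \ {x} : Set ℂ)) else 0 := by
  rw [removalKernel, Kernel.sum_apply, lintegral_sum_measure]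
  have : ∀ i : ℕ × ℕ, ∫⁻ q, f q ∂((⟨removalMeasure i.1 i.2, measurable_removalMeasure i.1 i.2⟩ :
      Kernel Config (ℂ × Config)) S) = ∑' x : ℂ, if x ∈ S ∧ x ∈ annulus i.1 ∧
        pointCount S (annulus i.1) = i.2 then f (x, (S \ {x} : Set ℂ)) else 0 :=
    fun i => lintegral_removalMeasure _ _ _ hf
  simp_rw [this]
  rw [ENNReal.tsum_comm]
  refine tsum_congr fun x => ?_
  by_cases hx : x ∈ S
  · obtain ⟨m, hm⟩ := (hS ⌊‖x‖⌋₊).exists_encard_eq_coe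
    -- Each point of `S` is charged by a single piece: that of its annulus and of the number of
    -- points there, finite by local finiteness.
    rw [tsum_eq_single (⌊‖x‖⌋₊, m)]
    · rw [if_pos ⟨hx, rfl, by rw [pointCount, hm]; rfl⟩, if_pos hx]
    · rintro ⟨k, n⟩ hne
      rw [if_neg]
      rintro ⟨-, rfl, hn⟩
      apply hne
      rw [pointCount, hm] at hn
      have : m = n := by simpa using hn
      simp [this]
  · simp [hx]

/-! ### Poisson counts and Mecke's formula -/

lemma tsum_ofReal_poisson {m : ℝ} (hm : 0 ≤ m) :
    ∑' k : ℕ, ENNReal.ofReal (Real.exp (-m) * m ^ k / (k.factorial : ℝ)) = 1 := by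
  have h : HasSum (fun k : ℕ => Real.exp (-m) * m ^ k / (k.factorial : ℝ)) 1 :=
    hasSum_one_poissonMeasure ⟨m, hm⟩
  rw [← ENNReal.ofReal_tsum_of_nonneg (fun k => by positivity) h.summable, h.tsum_eq,
    ENNReal.ofReal_one]

lemma tsum_mul_ofReal_poisson {m : ℝ} (hm : 0 ≤ m) :
    ∑' k : ℕ, (k : ℝ≥0∞) * ENNReal.ofReal (Real.exp (-m) * m ^ k / (k.factorial : ℝ)) =
      ENNReal.ofReal m := by
  rw [tsum_eq_zero_add' ENNReal.summable]
  simp only [Nat.cast_zero, zero_mul, zero_add]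
  have : ∀ k : ℕ, ((k + 1 : ℕ) : ℝ≥0∞) *
      ENNReal.ofReal (Real.exp (-m) * m ^ (k + 1) / ((k + 1).factorial : ℝ)) =
      ENNReal.ofReal m * ENNReal.ofReal (Real.exp (-m) * m ^ k / (k.factorial : ℝ)) := by
    intro k
    rw [← ENNReal.ofReal_natCast, ← ENNReal.ofReal_mul (by positivity),
      ← ENNReal.ofReal_mul hm]
    congr 1
    rw [Nat.factorial_succ]
    push_cast
    field_simp
    ring
  simp_rw [this]
  rw [ENNReal.tsum_mul_left, tsum_ofReal_poisson hm, mul_one]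

open Classical in
lemma pointCount_eq_tsum_annulus (S B : Set ℂ) :
    pointCount S B = ∑' k, pointCount S (B ∩ annulus k) := by
  simp_rw [pointCount_eq_tsum]
  rw [ENNReal.tsum_comm]
  refine tsum_congr fun x => ?_
  rw [tsum_eq_single ⌊‖x‖⌋₊]
  · simp [annulus]
  · intro k hk
    rw [if_neg]
    rintro ⟨-, -, rfl⟩
    exact hk rfl

lemma volume_eq_tsum_annulus {B : Set ℂ} (hB : MeasurableSet B) :
    volume B = ∑' k, volume (B ∩ annulus k) := by
  have : B = ⋃ k, B ∩ annulus k := by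
    ext z; simp [annulus]
  conv_lhs => rw [this]
  refine measure_iUnion (fun i j hij => ?_) fun k => hB.inter (measurableSet_annulus k)
  refine Set.disjoint_left.2 ?_
  rintro z ⟨-, rfl⟩ ⟨-, rfl⟩
  exact hij rfl

lemma pointCount_inter_add_diff (S C A : Set ℂ) :
    pointCount S C = pointCount S (A ∩ C) + pointCount S (C \ A) := by
  rw [pointCount, pointCount, pointCount, ← ENat.toENNReal_add, ← encard_union_eq]
  · congr 2
    ext z; simp only [mem_inter_iff, mem_union, mem_sdiff]; tauto
  · refine Set.disjoint_left.2 ?_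
    rintro z ⟨-, h, -⟩ ⟨-, -, h'⟩
    exact h' h

lemma pointCount_eq_zero_or_one_le {α : Type*} (S B : Set α) :
    pointCount S B = 0 ∨ 1 ≤ pointCount S B := by
  by_cases h : (S ∩ B).Nonempty
  · right
    rw [pointCount, ← ENat.toENNReal_one, ENat.toENNReal_le, one_le_encard_iff_nonempty]
    exact h
  · left
    rw [Set.not_nonempty_iff_eq_empty] at h
    simp [pointCount, h]

namespace IsPoissonProcess

variable {Ω : Type*} [MeasurableSpace Ω] {P : Measure Ω} {lam : ℝ} {Φ : Ω → Set ℂ}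

lemma measurable_count (hΦ : IsPoissonProcess P lam Φ) {B : Set ℂ} (hB : MeasurableSet B) :
    Measurable fun ω => pointCount (Φ ω) B :=
  (measurable_pointCount hB).comp hΦ.measurable_process

lemma lintegral_count_of_ne_top [IsProbabilityMeasure P] (hΦ : IsPoissonProcess P lam Φ)
    (hlam : 0 ≤ lam) {B : Set ℂ} (hB : MeasurableSet B) (hB' : volume B ≠ ∞) :
    ∫⁻ ω, pointCount (Φ ω) B ∂P = ENNReal.ofReal lam * volume B := by
  have hm : 0 ≤ lam * (volume B).toReal := by positivity
  set A : ℕ → Set Ω := fun k => {ω | pointCount (Φ ω) B = (k : ℝ≥0∞)} with hA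
  have hAm : ∀ k, MeasurableSet (A k) := fun k =>
    hΦ.measurable_count hB (measurableSet_singleton _)
  have hdisj : Pairwise (fun i j => Disjoint (A i) (A j)) := by
    intro i j hij
    refine Set.disjoint_left.2 fun ω hi hj => hij ?_
    have : (i : ℝ≥0∞) = j := hi.symm.trans hj
    exact_mod_cast this
  -- The Poisson masses already add up to 1, so the count is almost surely finite.
  have hP : P (⋃ k, A k) = 1 := by
    rw [measure_iUnion hdisj hAm, ← tsum_ofReal_poisson hm]
    exact tsum_congr fun k => hΦ.law_count B hB hB' k
  have hae : ∀ᵐ ω ∂P, ω ∈ ⋃ k, A k := by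
    rw [← prob_compl_eq_zero_iff (MeasurableSet.iUnion hAm)] at hP
    exact hP
  rw [← Measure.restrict_eq_self_of_ae_mem hae, lintegral_iUnion hAm hdisj]
  have : ∀ k, ∫⁻ ω in A k, pointCount (Φ ω) B ∂P = (k : ℝ≥0∞) * ENNReal.ofReal
      (Real.exp (-(lam * (volume B).toReal)) * (lam * (volume B).toReal) ^ k /
        (k.factorial : ℝ)) := by
    intro k
    rw [setLIntegral_congr_fun (g := fun _ => (k : ℝ≥0∞)) (hAm k) (fun ω hω => hω),
      setLIntegral_const, hA, hΦ.law_count B hB hB' k]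
  simp_rw [this]
  rw [tsum_mul_ofReal_poisson hm, ENNReal.ofReal_mul hlam, ENNReal.ofReal_toReal hB']

lemma lintegral_count [IsProbabilityMeasure P] (hΦ : IsPoissonProcess P lam Φ)
    (hlam : 0 ≤ lam) {B : Set ℂ} (hB : MeasurableSet B) :
    ∫⁻ ω, pointCount (Φ ω) B ∂P = ENNReal.ofReal lam * volume B := by
  simp_rw [fun ω => pointCount_eq_tsum_annulus (Φ ω) B]
  rw [lintegral_tsum fun k =>
      (hΦ.measurable_count (hB.inter (measurableSet_annulus k))).aemeasurable,
    volume_eq_tsum_annulus hB, ← ENNReal.tsum_mul_left]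
  exact tsum_congr fun k => hΦ.lintegral_count_of_ne_top hlam
    (hB.inter (measurableSet_annulus k))
    (ne_top_of_le_ne_top (volume_annulus_ne_top k) (measure_mono inter_subset_right))

lemma ae_isLocallyFinite [IsProbabilityMeasure P] (hΦ : IsPoissonProcess P lam Φ)
    (hlam : 0 ≤ lam) : ∀ᵐ ω ∂P, IsLocallyFinite (Φ ω) := by
  refine ae_all_iff.2 fun k => ?_
  have := ae_lt_top (hΦ.measurable_count (measurableSet_annulus k)) (by
    rw [hΦ.lintegral_count hlam (measurableSet_annulus k)]
    exact ENNReal.mul_ne_top ENNReal.ofReal_ne_top (volume_annulus_ne_top k))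
  filter_upwards [this] with ω hω
  rwa [pointCount, ENat.toENNReal_lt_top, encard_lt_top_iff] at hω

lemma prob_void (hΦ : IsPoissonProcess P lam Φ) {C : Set ℂ} (hC : MeasurableSet C)
    (hC' : volume C ≠ ∞) : P {ω | pointCount (Φ ω) C = 0} =
      ENNReal.ofReal (Real.exp (-(lam * (volume C).toReal))) := by
  have := hΦ.law_count C hC hC' 0
  simpa using this

lemma prob_count_eq_one (hΦ : IsPoissonProcess P lam Φ) (hlam : 0 ≤ lam) {C : Set ℂ}
    (hC : MeasurableSet C) (hC' : volume C ≠ ∞) : P {ω | pointCount (Φ ω) C = 1} =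
      ENNReal.ofReal lam * volume C * P {ω | pointCount (Φ ω) C = 0} := by
  have := hΦ.law_count C hC hC' 1
  simp only [Nat.cast_one, pow_one, Nat.factorial_one, div_one] at this
  rw [this, hΦ.prob_void hC hC', ENNReal.ofReal_mul (by positivity), ENNReal.ofReal_mul hlam,
    ENNReal.ofReal_toReal hC', mul_comm]

lemma indepFun_count (hΦ : IsPoissonProcess P lam Φ) {A B : Set ℂ} (hA : MeasurableSet A)
    (hB : MeasurableSet B) (hAB : Disjoint A B) :
    IndepFun (fun ω => pointCount (Φ ω) A) (fun ω => pointCount (Φ ω) B) P := by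
  have := (hΦ.indep_count 2 ![A, B] (by intro i; fin_cases i <;> assumption) (by
    intro i j hij
    fin_cases i <;> fin_cases j <;> simp_all [disjoint_comm])).indepFun
      (show (0 : Fin 2) ≠ 1 by decide)
  simpa using this

lemma prob_void_union (hΦ : IsPoissonProcess P lam Φ) {A C : Set ℂ} (hA : MeasurableSet A)
    (hC : MeasurableSet C) :
    P {ω | pointCount (Φ ω) C = 0} =
      P {ω | pointCount (Φ ω) (A ∩ C) = 0} * P {ω | pointCount (Φ ω) (C \ A) = 0} := by
  have h := (hΦ.indepFun_count (hA.inter hC) (hC.diff hA)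
    (Set.disjoint_left.2 fun z hz hz' => hz'.2 hz.1)).measure_inter_preimage_eq_mul {0} {0}
    (measurableSet_singleton _) (measurableSet_singleton _)
  refine Eq.trans ?_ h
  congr 1
  ext ω
  simp [pointCount_inter_add_diff (Φ ω) C A]

open Classical in
-- The points outside `C` contribute λ|A \ C| P(`C` void), by independence of the counts in `C` and
-- `A \ C`. Those inside contribute P(one point in `A ∩ C`) P(`C \ A` void), and the Poisson
-- identity P(N = 1) = λ|A ∩ C| P(N = 0) turns this into λ|A ∩ C| P(`C` void).
lemma lintegral_removal_voidBox [IsProbabilityMeasure P] (hΦ : IsPoissonProcess P lam Φ)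
    (hlam : 0 ≤ lam) {A C : Set ℂ} (hA : MeasurableSet A) (hC : MeasurableSet C)
    (hC' : volume C ≠ ∞) :
    ∫⁻ ω, removalKernel (Φ ω) (A ×ˢ voidEvent C) ∂P =
      ENNReal.ofReal lam * volume A * P {ω | pointCount (Φ ω) C = 0} := by
  have hCA : volume (A ∩ C) ≠ ∞ := ne_top_of_le_ne_top hC' (measure_mono inter_subset_right)
  have hae : (fun ω => removalKernel (Φ ω) (A ×ˢ voidEvent C)) =ᵐ[P] fun ω =>
      (if pointCount (Φ ω) C = 0 then pointCount (Φ ω) (A \ C) else 0) +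
      (if pointCount (Φ ω) C = 1 then pointCount (Φ ω) (A ∩ C) else 0) := by
    filter_upwards [hΦ.ae_isLocallyFinite hlam] with ω hω
    have hE : MeasurableSet (A ×ˢ voidEvent C) := hA.prod (measurableSet_voidEvent hC)
    rw [← lintegral_indicator_one hE,
      lintegral_removalKernel hω (measurable_one.indicator hE), ← tsum_removal_indicator]
    refine tsum_congr fun x => ?_
    by_cases hx : x ∈ Φ ω <;> by_cases hxA : x ∈ A <;>
      by_cases hd : Disjoint (Φ ω \ {x}) C <;> simp [hx, hxA, hd, voidEvent]
  have hcount : ∀ (B : Set ℂ) (c : ℝ≥0∞), MeasurableSet B →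
      MeasurableSet {ω | pointCount (Φ ω) B = c} := fun B c hB =>
    hΦ.measurable_count hB (measurableSet_singleton c)
  rw [lintegral_congr_ae hae, lintegral_add_left (Measurable.ite (hcount _ _ hC)
    (hΦ.measurable_count (hA.diff hC)) measurable_const)]
  have e1 : ∫⁻ ω, (if pointCount (Φ ω) C = 0 then pointCount (Φ ω) (A \ C) else 0) ∂P =
      P {ω | pointCount (Φ ω) C = 0} * (ENNReal.ofReal lam * volume (A \ C)) := by
    have hind : IndepFun (fun ω => (indicator {0} 1 : ℝ≥0∞ → ℝ≥0∞) (pointCount (Φ ω) C))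
        (fun ω => pointCount (Φ ω) (A \ C)) P :=
      (hΦ.indepFun_count hC (hA.diff hC) disjoint_sdiff_right).comp
        (measurable_one.indicator (measurableSet_singleton 0)) measurable_id
    have := lintegral_mul_eq_lintegral_mul_lintegral_of_indepFun
      ((measurable_one.indicator (measurableSet_singleton 0)).comp (hΦ.measurable_count hC))
      (hΦ.measurable_count (hA.diff hC)) hind
    rw [hΦ.lintegral_count hlam (hA.diff hC)] at this
    rw [← lintegral_indicator_one (hcount C 0 hC)]
    refine Eq.trans (lintegral_congr fun ω => ?_) (this.trans ?_)
    · by_cases h : pointCount (Φ ω) C = 0 <;> simp [h]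
    · rfl
  have e2 : ∫⁻ ω, (if pointCount (Φ ω) C = 1 then pointCount (Φ ω) (A ∩ C) else 0) ∂P =
      P {ω | pointCount (Φ ω) C = 0} * (ENNReal.ofReal lam * volume (A ∩ C)) := by
    -- If the only point of `C` lies in `C \ A`, the summand is 0; otherwise it is 1.
    have hset : (fun ω => if pointCount (Φ ω) C = 1 then pointCount (Φ ω) (A ∩ C) else 0) =
        indicator ({ω | pointCount (Φ ω) (A ∩ C) = 1} ∩ {ω | pointCount (Φ ω) (C \ A) = 0})
          1 := by
      funext ω
      have hadd := pointCount_inter_add_diff (Φ ω) C A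
      by_cases h : pointCount (Φ ω) (A ∩ C) = 1 ∧ pointCount (Φ ω) (C \ A) = 0
      · rw [indicator_of_mem (show ω ∈ _ ∩ _ from h), if_pos (by rw [hadd, h.1, h.2, add_zero]),
          h.1]
        rfl
      · rw [indicator_of_notMem (show ω ∉ _ ∩ _ from h)]
        split_ifs with h1
        · rcases pointCount_eq_zero_or_one_le (Φ ω) (A ∩ C) with h0 | h0
          · exact h0
          · exfalso
            apply h
            rw [h1] at hadd
            have h2 : pointCount (Φ ω) (A ∩ C) = 1 :=
              le_antisymm (by rw [hadd]; exact le_self_add) h0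
            refine ⟨h2, ?_⟩
            rw [h2] at hadd
            exact (ENNReal.add_right_inj ENNReal.one_ne_top).1 (by rw [← hadd, add_zero])
        · rfl
    have hmeas : P ({ω | pointCount (Φ ω) (A ∩ C) = 1} ∩ {ω | pointCount (Φ ω) (C \ A) = 0}) =
        P {ω | pointCount (Φ ω) (A ∩ C) = 1} * P {ω | pointCount (Φ ω) (C \ A) = 0} :=
      (hΦ.indepFun_count (hA.inter hC) (hC.diff hA)
        (Set.disjoint_left.2 fun z hz hz' => hz'.2 hz.1)).measure_inter_preimage_eq_mul {1} {0}
        (measurableSet_singleton _) (measurableSet_singleton _)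
    rw [hset, lintegral_indicator_one ((hcount _ _ (hA.inter hC)).inter (hcount _ _ (hC.diff hA))),
      hmeas, hΦ.prob_count_eq_one hlam (hA.inter hC) hCA, hΦ.prob_void_union hA hC]
    ring
  rw [e1, e2, ← mul_add, ← mul_add, add_comm (volume (A \ C)), measure_inter_add_sdiff A hC]
  ring

/-- The law of a Poisson process. -/
noncomputable def law (_ : IsPoissonProcess P lam Φ) : Measure Config := P.map Φ

instance (hΦ : IsPoissonProcess P lam Φ) [IsProbabilityMeasure P] :
    IsProbabilityMeasure hΦ.law :=
  Measure.isProbabilityMeasure_map hΦ.measurable_process.aemeasurable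

/-- This is Mecke's formula as an identity of measures; agreement on the generating π-system
suffices because balls times the whole space exhaust the product with finite mass. -/
lemma bind_removalKernel [IsProbabilityMeasure P] (hΦ : IsPoissonProcess P lam Φ)
    (hlam : 0 ≤ lam) :
    hΦ.law.bind removalKernel = (ENNReal.ofReal lam • (volume : Measure ℂ)).prod hΦ.law := by
  have hbox : ∀ A C : Set ℂ, MeasurableSet A → MeasurableSet C → volume C ≠ ∞ →
      hΦ.law.bind removalKernel (A ×ˢ voidEvent C) =
        (ENNReal.ofReal lam • (volume : Measure ℂ)).prod hΦ.law (A ×ˢ voidEvent C) := by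
    intro A C hA hC hC'
    have hE := hA.prod (measurableSet_voidEvent hC)
    rw [Measure.bind_apply hE removalKernel.measurable.aemeasurable, law,
      lintegral_map (Kernel.measurable_coe removalKernel hE) hΦ.measurable_process,
      hΦ.lintegral_removal_voidBox hlam hA hC hC', Measure.prod_prod, Measure.smul_apply,
      Measure.map_apply hΦ.measurable_process (measurableSet_voidEvent hC), smul_eq_mul]
    congr 2
    ext ω; exact pointCount_eq_zero
  refine Measure.ext_of_generateFrom_of_iUnion voidBoxes
    (fun k : ℕ => Metric.closedBall (0 : ℂ) k ×ˢ univ) generateFrom_voidBoxes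
    isPiSystem_voidBoxes ?_ ?_ ?_ ?_
  · rw [← iUnion_prod_const, Metric.iUnion_closedBall_nat, univ_prod_univ]
  · exact fun k => ⟨_, (Metric.isClosed_closedBall.measurableSet :
      MeasurableSet (Metric.closedBall (0 : ℂ) k)), univ, univ_mem_voidEvents, rfl⟩
  · intro k
    -- The whole space is the void event of ∅, so the finite mass follows from the identity on
    -- boxes.
    rw [← voidEvent_empty, hbox _ _ Metric.isClosed_closedBall.measurableSet MeasurableSet.empty
      (by simp), Measure.prod_prod]
    exact ENNReal.mul_ne_top (ENNReal.mul_ne_top ENNReal.ofReal_ne_top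
      measure_closedBall_lt_top.ne) (measure_ne_top _ _)
  · rintro _ ⟨A, hA, _, ⟨C, hC, hC', rfl⟩, rfl⟩
    exact hbox A C hA hC hC'

/-- **Mecke's formula.** -/
lemma lintegral_lintegral_removalKernel [IsProbabilityMeasure P]
    (hΦ : IsPoissonProcess P lam Φ) (hlam : 0 ≤ lam) {f : ℂ × Config → ℝ≥0∞}
    (hf : Measurable f) :
    ∫⁻ S, ∫⁻ q, f q ∂removalKernel S ∂hΦ.law =
      ENNReal.ofReal lam * ∫⁻ x, ∫⁻ S, f (x, S) ∂hΦ.law := by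
  rw [← Measure.lintegral_bind removalKernel.measurable.aemeasurable hf.aemeasurable,
    hΦ.bind_removalKernel hlam, lintegral_prod _ hf.aemeasurable, lintegral_smul_measure,
    smul_eq_mul]

end IsPoissonProcess

/-! ### Voronoi facets and crossings in general position -/

lemma mem_voronoiFacet_iff {S : Set ℂ} {X Y z : ℂ} (hX : X ∈ S) (hY : Y ∈ S) (hXY : X ≠ Y) :
    z ∈ voronoiFacet S X Y ↔ dist z X = dist z Y ∧ ∀ W ∈ S, dist z X ≤ dist z W := by
  constructor
  · rintro ⟨h1, h2⟩
    refine ⟨le_antisymm (h1 Y hY hXY.symm) (h2 X hX hXY), fun W hW => ?_⟩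
    by_cases h : W = X
    · rw [h]
    · exact h1 W hW h
  · rintro ⟨h1, h2⟩
    exact ⟨fun W hW _ => h2 W hW, fun W hW _ => h1 ▸ h2 W hW⟩

lemma IsLocallyFinite.finite_inter_closedBall {S : Set ℂ} (hS : IsLocallyFinite S) (z : ℂ)
    (r : ℝ) : (S ∩ Metric.closedBall z r).Finite := by
  refine ((finite_Iic ⌊‖z‖ + r⌋₊).biUnion fun k _ => hS k).subset ?_
  rintro w ⟨hw, hwr⟩
  refine mem_biUnion (x := ⌊‖w‖⌋₊) (Nat.floor_le_floor ?_) ⟨hw, rfl⟩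
  rw [Metric.mem_closedBall, dist_eq_norm] at hwr
  calc ‖w‖ = ‖z + (w - z)‖ := by ring_nf
    _ ≤ ‖z‖ + r := (norm_add_le _ _).trans (by linarith)

/-- Only finitely many points lie within r + 1 of `z`, so those beyond distance r have a nearest
one. -/
lemma IsLocallyFinite.exists_gap {S : Set ℂ} (hS : IsLocallyFinite S) (z : ℂ) (r : ℝ) :
    ∃ δ > 0, ∀ W ∈ S, r < dist z W → r + δ ≤ dist z W := by
  have hF : {W ∈ S ∩ Metric.closedBall z (r + 1) | r < dist z W}.Finite :=
    (hS.finite_inter_closedBall z (r + 1)).subset (sep_subset _ _)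
  rcases Set.eq_empty_or_nonempty {W ∈ S ∩ Metric.closedBall z (r + 1) | r < dist z W} with he | hne
  · refine ⟨1, one_pos, fun W hW h => ?_⟩
    by_contra! h'
    have : W ∈ {W ∈ S ∩ Metric.closedBall z (r + 1) | r < dist z W} :=
      ⟨⟨hW, by rw [Metric.mem_closedBall, dist_comm]; exact h'.le⟩, h⟩
    rw [he] at this; exact this
  · obtain ⟨W₀, hW₀, hmin⟩ := Set.exists_min_image _ (fun W => dist z W) hF hne
    refine ⟨min 1 (dist z W₀ - r), lt_min one_pos (sub_pos.2 hW₀.2), fun W hW h => ?_⟩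
    by_cases h' : dist z W ≤ r + 1
    · have := hmin W ⟨⟨hW, by rw [Metric.mem_closedBall, dist_comm]; exact h'⟩, h⟩
      linarith [min_le_right 1 (dist z W₀ - r)]
    · linarith [min_le_left 1 (dist z W₀ - r)]

lemma dist_eq_dist_iff_inner {z X Y : ℂ} : dist z X = dist z Y ↔
    2 * ((z.re * (Y.re - X.re)) + z.im * (Y.im - X.im)) =
      Y.re ^ 2 + Y.im ^ 2 - (X.re ^ 2 + X.im ^ 2) := by
  rw [dist_eq_norm, dist_eq_norm, ← sq_eq_sq₀ (norm_nonneg _) (norm_nonneg _),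
    ← Complex.normSq_eq_norm_sq, ← Complex.normSq_eq_norm_sq, Complex.normSq_apply,
    Complex.normSq_apply]
  simp only [Complex.sub_re, Complex.sub_im]
  constructor <;> intro h <;> linarith

/-- By the gap between `X`, `Y` and the other nuclei, a short move along the bisector keeps `X` and
`Y` nearest. -/
lemma voronoiFacet_nontrivial {S : Set ℂ} (hS : IsLocallyFinite S) {X Y z : ℂ} (hX : X ∈ S)
    (hY : Y ∈ S) (hXY : X ≠ Y) (hz : dist z X = dist z Y)
    (hW : ∀ W ∈ S, W ≠ X → W ≠ Y → dist z X < dist z W) : (voronoiFacet S X Y).Nontrivial := by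
  obtain ⟨δ, hδ, hgap⟩ := hS.exists_gap z (dist z X)
  have hn : 0 < ‖X - Y‖ := norm_pos_iff.2 (sub_ne_zero.2 hXY)
  -- The displacement is parallel to the bisector and has length δ/2, so each of the two distances
  -- compared changes by at most half the gap.
  set ε : ℝ := δ / (2 * ‖X - Y‖) with hε
  have hε0 : 0 < ε := by positivity
  set z' : ℂ := z + (ε : ℂ) * (Complex.I * (X - Y)) with hz'
  have hdist : dist z' z = δ / 2 := by
    rw [dist_eq_norm, hz', add_sub_cancel_left, norm_mul, norm_mul, Complex.norm_I, one_mul,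
      Complex.norm_real, Real.norm_of_nonneg hε0.le, hε]
    field_simp
  have heq : dist z' X = dist z' Y := by
    rw [dist_eq_dist_iff_inner] at hz ⊢
    rw [← hz, hz']
    simp
    ring
  refine ⟨z, (mem_voronoiFacet_iff hX hY hXY).2 ⟨hz, fun W hWS => ?_⟩, z',
    (mem_voronoiFacet_iff hX hY hXY).2 ⟨heq, fun W hWS => ?_⟩, ?_⟩
  · by_cases h1 : W = X
    · rw [h1]
    · by_cases h2 : W = Y
      · rw [h2, hz]
      · exact (hW W hWS h1 h2).le
  · by_cases h1 : W = X
    · rw [h1]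
    · by_cases h2 : W = Y
      · rw [h2, heq]
      · have h3 := hgap W hWS (hW W hWS h1 h2)
        have h4 := dist_triangle z' z X
        have h5 := dist_triangle z z' W
        rw [dist_comm z z'] at h5
        linarith
  · intro h
    rw [← h, dist_self] at hdist
    linarith

/-- The coordinates of a point in the frame whose first axis is the line with direction angle `φ`
and signed distance `p` to the origin. -/
noncomputable def lineFrame (φ p : ℝ) (X : ℂ) : ℂ :=
  X * Complex.exp (-((φ : ℂ) * Complex.I)) - (p : ℂ) * Complex.I

lemma dist_linePoint (φ p s : ℝ) (X : ℂ) :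
    dist (linePoint φ p s) X = ‖(s : ℂ) - lineFrame φ p X‖ := by
  have h : linePoint φ p s - X =
      ((s : ℂ) - lineFrame φ p X) * Complex.exp ((φ : ℂ) * Complex.I) := by
    have : Complex.exp (-((φ : ℂ) * Complex.I)) * Complex.exp ((φ : ℂ) * Complex.I) = 1 := by
      rw [← Complex.exp_add, neg_add_cancel, Complex.exp_zero]
    simp only [linePoint, lineFrame]
    linear_combination X * this
  rw [dist_eq_norm, h, norm_mul, Complex.norm_exp_ofReal_mul_I, mul_one]

/-- The coordinate of the point of the line at which the bisector of `X` and `Y` crosses it. -/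
noncomputable def bisectorCoord (φ p : ℝ) (X Y : ℂ) : ℝ :=
  (Complex.normSq (lineFrame φ p X) - Complex.normSq (lineFrame φ p Y)) /
    (2 * ((lineFrame φ p X).re - (lineFrame φ p Y).re))

lemma dist_linePoint_eq_iff {φ p s : ℝ} {X Y : ℂ}
    (h : (lineFrame φ p X).re ≠ (lineFrame φ p Y).re) :
    dist (linePoint φ p s) X = dist (linePoint φ p s) Y ↔ s = bisectorCoord φ p X Y := by
  rw [dist_linePoint, dist_linePoint, ← dist_eq_norm, ← dist_eq_norm, dist_eq_dist_iff_inner,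
    bisectorCoord, eq_div_iff (by have := sub_ne_zero.2 h; positivity), Complex.normSq_apply,
    Complex.normSq_apply]
  simp only [Complex.ofReal_re, Complex.ofReal_im]
  constructor <;> intro h <;> linarith

/-- The point of the line at which the bisector of `X` and `Y` crosses it. -/
noncomputable def bisectorPoint (φ p : ℝ) (X Y : ℂ) : ℂ := linePoint φ p (bisectorCoord φ p X Y)

/-- A locally finite configuration in general position with respect to a line. -/
structure InGeneralPosition (S : Set ℂ) (φ p : ℝ) : Prop where
  locallyFinite : IsLocallyFinite S
  re_ne : ∀ X ∈ S, ∀ Y ∈ S, X ≠ Y → X.re ≠ Y.re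
  frame_ne : ∀ X ∈ S, ∀ Y ∈ S, X ≠ Y → (lineFrame φ p X).re ≠ (lineFrame φ p Y).re
  dist_ne : ∀ X ∈ S, ∀ Y ∈ S, ∀ W ∈ S, X ≠ Y → W ≠ X → W ≠ Y →
    dist (bisectorPoint φ p X Y) W ≠ dist (bisectorPoint φ p X Y) X

/-- `X`, on the left of `Y`, and `Y` are the nuclei nearest to the point of the line that is
equidistant to them. -/
def IsCrossingPair (S : Set ℂ) (φ p : ℝ) (X Y : ℂ) : Prop :=
  X ∈ S ∧ Y ∈ S ∧ X.re < Y.re ∧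
    ∀ W ∈ S, dist (bisectorPoint φ p X Y) X ≤ dist (bisectorPoint φ p X Y) W

namespace InGeneralPosition

variable {S : Set ℂ} {φ p : ℝ}

/-- Distinct abscissas make tie-breaking irrelevant, and the absence of a third equidistant nucleus
makes the facet a nondegenerate segment automatically. -/
lemma isOrderedNeighbours_iff (h : InGeneralPosition S φ p) {s : ℝ} {X Y : ℂ} :
    IsOrderedNeighbours S (linePoint φ p s) X Y ↔
      IsCrossingPair S φ p X Y ∧ s = bisectorCoord φ p X Y := by
  constructor
  · rintro ⟨hlt, ⟨hX, hY, hne, -⟩, hz⟩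
    rw [mem_voronoiFacet_iff hX hY hne, dist_linePoint_eq_iff (h.frame_ne X hX Y hY hne)] at hz
    refine ⟨⟨hX, hY, ?_, ?_⟩, hz.1⟩
    · exact hlt.resolve_right fun h' => h.re_ne X hX Y hY hne h'.1
    · rw [bisectorPoint, ← hz.1]; exact hz.2
  · rintro ⟨⟨hX, hY, hlt, hmin⟩, rfl⟩
    have hne : X ≠ Y := fun h' => hlt.ne (by rw [h'])
    have hd := (dist_linePoint_eq_iff (s := bisectorCoord φ p X Y)
      (h.frame_ne X hX Y hY hne)).2 rfl
    refine ⟨Or.inl hlt, ⟨hX, hY, hne, ?_⟩, (mem_voronoiFacet_iff hX hY hne).2 ⟨hd, hmin⟩⟩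
    refine voronoiFacet_nontrivial h.locallyFinite hX hY hne hd fun W hW h1 h2 => ?_
    exact lt_of_le_of_ne (hmin W hW) (h.dist_ne X hX Y hY W hW hne h1 h2).symm

/-- All four nuclei are at the minimal distance from the common crossing, where only two can be; the
left-right order then identifies the pairs. -/
lemma crossingPair_unique (h : InGeneralPosition S φ p) {X Y X' Y' : ℂ}
    (hXY : IsCrossingPair S φ p X Y) (hXY' : IsCrossingPair S φ p X' Y')
    (hs : bisectorCoord φ p X Y = bisectorCoord φ p X' Y') : X' = X ∧ Y' = Y := by
  obtain ⟨hX, hY, hlt, hmin⟩ := hXY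
  obtain ⟨hX', hY', hlt', hmin'⟩ := hXY'
  have hne : X ≠ Y := fun h' => hlt.ne (by rw [h'])
  have hne' : X' ≠ Y' := fun h' => hlt'.ne (by rw [h'])
  have hz : bisectorPoint φ p X' Y' = bisectorPoint φ p X Y := by
    rw [bisectorPoint, bisectorPoint, hs]
  have hd' : dist (bisectorPoint φ p X' Y') X' = dist (bisectorPoint φ p X' Y') Y' :=
    (dist_linePoint_eq_iff (h.frame_ne X' hX' Y' hY' hne')).2 rfl
  rw [hz] at hd' hmin'
  have e1 := le_antisymm (hmin' X hX) (hmin X' hX')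
  have key : ∀ W ∈ S, dist (bisectorPoint φ p X Y) W = dist (bisectorPoint φ p X Y) X →
      W = X ∨ W = Y := by
    intro W hW hWd
    by_contra! hcon
    exact h.dist_ne X hX Y hY W hW hne hcon.1 hcon.2 hWd
  rcases key X' hX' e1 with h1 | h1 <;> rcases key Y' hY' (hd' ▸ e1) with h2 | h2
  · exact absurd (h1.trans h2.symm) hne'
  · exact ⟨h1, h2⟩
  · rw [h1, h2] at hlt'; exact absurd hlt' hlt.not_gt
  · exact absurd (h1.trans h2.symm) hne'

lemma existsUnique_orderedNeighbours (h : InGeneralPosition S φ p) {s : ℝ}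
    (hs : s ∈ crossings S φ p) :
    ∃! q : ℂ × ℂ, IsOrderedNeighbours S (linePoint φ p s) q.1 q.2 := by
  have hex : ∃ X Y, IsOrderedNeighbours S (linePoint φ p s) X Y := by
    obtain ⟨X, Y, hD, hz⟩ := hs
    obtain ⟨hX, hY, hne, hnt⟩ := hD
    rcases lt_or_gt_of_ne (h.re_ne X hX Y hY hne) with hlt | hlt
    · exact ⟨X, Y, Or.inl hlt, ⟨hX, hY, hne, hnt⟩, hz⟩
    · refine ⟨Y, X, Or.inl hlt, ⟨hY, hX, hne.symm, ?_⟩, ?_⟩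
      · rwa [voronoiFacet, inter_comm]
      · rwa [voronoiFacet, inter_comm]
  obtain ⟨X, Y, hXY⟩ := hex
  refine ⟨(X, Y), hXY, ?_⟩
  rintro ⟨X', Y'⟩ hXY'
  rw [h.isOrderedNeighbours_iff] at hXY
  rw [h.isOrderedNeighbours_iff] at hXY'
  have := h.crossingPair_unique hXY.1 hXY'.1 (hXY.2.symm.trans hXY'.2)
  exact Prod.ext this.1 this.2

lemma pointCount_markedCrossings (h : InGeneralPosition S φ p) (I B : Set ℝ) :
    pointCount (markedCrossings S φ p) (I ×ˢ B) =
      (({q : ℂ × ℂ | IsCrossingPair S φ p q.1 q.2 ∧ bisectorCoord φ p q.1 q.2 ∈ I ∧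
        clockwiseAngle q.1 (bisectorPoint φ p q.1 q.2) q.2 ∈ B}).encard : ℝ≥0∞) := by
  set G : Set (ℂ × ℂ) := {q | IsCrossingPair S φ p q.1 q.2 ∧ bisectorCoord φ p q.1 q.2 ∈ I ∧
        clockwiseAngle q.1 (bisectorPoint φ p q.1 q.2) q.2 ∈ B} with hG
  -- The position alone determines the pair, so crossings can be counted through pairs.
  have hinj : InjOn (fun q : ℂ × ℂ => (bisectorCoord φ p q.1 q.2,
      clockwiseAngle q.1 (bisectorPoint φ p q.1 q.2) q.2)) G := by
    rintro ⟨X, Y⟩ hq ⟨X', Y'⟩ hq' heq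
    have := h.crossingPair_unique hq.1 hq'.1 (congrArg Prod.fst heq)
    exact (Prod.ext this.1 this.2).symm
  rw [pointCount, ← hinj.encard_image]
  congr 2
  ext ⟨s, θ⟩
  constructor
  · rintro ⟨⟨X, Y, hXY, hθ⟩, hI, hB⟩
    rw [h.isOrderedNeighbours_iff] at hXY
    obtain ⟨hXY, hs⟩ := hXY
    dsimp only at hs hθ hI hB
    subst hs hθ
    exact ⟨(X, Y), ⟨hXY, hI, hB⟩, rfl⟩
  · rintro ⟨⟨X, Y⟩, ⟨hXY, hI, hB⟩, heq⟩
    simp only [Prod.mk.injEq] at heq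
    obtain ⟨rfl, rfl⟩ := heq
    exact ⟨⟨X, Y, h.isOrderedNeighbours_iff.2 ⟨hXY, rfl⟩, rfl⟩, hI, hB⟩

end InGeneralPosition

/-! ### Change of variables for pairs of points -/

lemma lintegral_comp_add_mul {f : ℂ → ℝ≥0∞} (hf : Measurable f) (z : ℂ) {a : ℂ} (ha : ‖a‖ = 1) :
    ∫⁻ w, f (z + a * w) = ∫⁻ x, f x := by
  have h := (rotation ⟨a, mem_sphere_zero_iff_norm.2 ha⟩).measurePreserving
  rw [← lintegral_add_left_eq_self f z]
  exact h.lintegral_comp (f := fun x => f (z + x)) (by fun_prop)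

/-- The factor `ENNReal.ofReal r` vanishes for r ≤ 0, so the radius may range over all of ℝ, which
leaves it open to affine substitutions. -/
lemma lintegral_eq_polar {f : ℂ → ℝ≥0∞} (hf : Measurable f) :
    ∫⁻ w, f w = ∫⁻ γ in Ioo (-Real.pi) Real.pi, ∫⁻ r : ℝ, ENNReal.ofReal r *
      f (r * Complex.exp ((γ : ℂ) * Complex.I)) := by
  rw [← Complex.lintegral_comp_polarCoord_symm,
    show polarCoord.target = Ioi (0 : ℝ) ×ˢ Ioo (-Real.pi) Real.pi from rfl,
    Measure.volume_eq_prod, ← Measure.prod_restrict, lintegral_prod_symm]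
  · refine lintegral_congr fun γ => ?_
    rw [← lintegral_indicator measurableSet_Ioi]
    refine lintegral_congr fun r => ?_
    by_cases hr : 0 < r
    · rw [indicator_of_mem (mem_Ioi.2 hr), Complex.polarCoord_symm_apply, Complex.exp_mul_I]
      simp
    · rw [indicator_of_notMem (by simpa using hr), ENNReal.ofReal_of_nonpos (not_lt.1 hr), zero_mul]
  · simp_rw [Complex.polarCoord_symm_apply]
    refine Measurable.aemeasurable ?_
    simp_rw [smul_eq_mul]
    fun_prop

lemma lintegral_comp_affine {f : ℝ → ℝ≥0∞} (hf : Measurable f) {a : ℝ} (ha : a ≠ 0) (b : ℝ) :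
    ∫⁻ x, f x = ∫⁻ s, ENNReal.ofReal |a| * f (a * s + b) := by
  rw [lintegral_const_mul _ (by fun_prop), ← lintegral_add_right_eq_self f b]
  conv_lhs => rw [← Real.smul_map_volume_mul_left ha]
  rw [lintegral_smul_measure, lintegral_map (by fun_prop) (by fun_prop), smul_eq_mul]

lemma ae_cos_sub_ne_zero (φ : ℝ) : ∀ᵐ γ : ℝ, Real.cos (γ - φ) ≠ 0 := by
  have : {γ : ℝ | Real.cos (γ - φ) = 0}.Countable := by
    have h : {γ : ℝ | Real.cos (γ - φ) = 0} ⊆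
        range fun k : ℤ => (2 * k + 1) * Real.pi / 2 + φ := by
      intro γ hγ
      obtain ⟨k, hk⟩ := Real.cos_eq_zero_iff.1 hγ
      exact ⟨k, by dsimp only; linarith⟩
    exact (countable_range _).mono h
  exact this.ae_notMem volume

lemma linePoint_eq_add (φ p s : ℝ) :
    linePoint φ p s = linePoint φ p 0 + s * Complex.exp ((φ : ℂ) * Complex.I) := by
  simp [linePoint]; ring

lemma re_linePoint_sub_mul (φ p s γ : ℝ) (x : ℂ) :
    2 * ((linePoint φ p s - x) * Complex.exp (-((γ : ℂ) * Complex.I))).re =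
      2 * Real.cos (γ - φ) * s +
        2 * ((linePoint φ p 0 - x) * Complex.exp (-((γ : ℂ) * Complex.I))).re := by
  have h : (linePoint φ p s - x) * Complex.exp (-((γ : ℂ) * Complex.I)) =
      s * Complex.exp (((φ - γ : ℝ) : ℂ) * Complex.I) +
        (linePoint φ p 0 - x) * Complex.exp (-((γ : ℂ) * Complex.I)) := by
    have : Complex.exp (((φ - γ : ℝ) : ℂ) * Complex.I) =
        Complex.exp ((φ : ℂ) * Complex.I) * Complex.exp (-((γ : ℂ) * Complex.I)) := by
      rw [← Complex.exp_add]; push_cast; ring_nf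
    rw [linePoint_eq_add, this]
    ring
  rw [h, Complex.add_re, Complex.re_ofReal_mul, Complex.exp_ofReal_mul_I_re, ← Real.cos_neg,
    neg_sub]
  ring

/-- Integration over pairs of points through the crossing `s` of their bisector with a line, the
direction `γ` of the pair, and the position `w` of the pair with respect to its bisector. -/
lemma lintegral_pair_eq_bisector (φ p : ℝ) {G : ℂ × ℂ → ℝ≥0∞} (hG : Measurable G) :
    ∫⁻ x, ∫⁻ y, G (x, y) = ∫⁻ s : ℝ, ∫⁻ γ in Ioo (-Real.pi) Real.pi,
      ENNReal.ofReal |2 * Real.cos (γ - φ)| * ∫⁻ w : ℂ, ENNReal.ofReal (2 * w.im) *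
        G (linePoint φ p s + Complex.I * Complex.exp ((γ : ℂ) * Complex.I) * w,
          linePoint φ p s + Complex.I * Complex.exp ((γ : ℂ) * Complex.I) * conj w) := by
  have hlp : Measurable (linePoint φ p) := by unfold linePoint; fun_prop
  -- The signed length for which the bisector of x and x + ρ e^{iγ} passes through the point of the
  -- line at s.
  set ρ : ℝ → ℝ → ℂ → ℝ := fun s γ x =>
    2 * ((linePoint φ p s - x) * Complex.exp (-((γ : ℂ) * Complex.I))).re with hρ
  set e : ℝ → ℂ := fun γ => Complex.exp ((γ : ℂ) * Complex.I) with he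
  set H : ℝ → ℝ → ℂ → ℝ≥0∞ := fun s γ x => ENNReal.ofReal |2 * Real.cos (γ - φ)| *
    (ENNReal.ofReal (ρ s γ x) * G (x, x + ρ s γ x * e γ)) with hH
  have hHm : Measurable fun q : ℝ × ℝ × ℂ => H q.1 q.2.1 q.2.2 := by
    simp only [hH, hρ, he]; fun_prop
  have h1 : ∀ x, ∫⁻ y, G (x, y) = ∫⁻ γ in Ioo (-Real.pi) Real.pi, ∫⁻ s, H s γ x := by
    intro x
    rw [← lintegral_add_left_eq_self (fun y => G (x, y)) x, lintegral_eq_polar (by fun_prop)]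
    refine lintegral_congr_ae (ae_restrict_of_ae ?_)
    filter_upwards [ae_cos_sub_ne_zero φ] with γ hγ
    -- For fixed x and γ, the length ρ is affine in s with slope 2 cos(γ - φ), nonzero for almost
    -- every γ.
    rw [lintegral_comp_affine (by fun_prop) (a := 2 * Real.cos (γ - φ)) (by positivity)
      (2 * ((linePoint φ p 0 - x) * Complex.exp (-((γ : ℂ) * Complex.I))).re)]
    refine lintegral_congr fun s => ?_
    rw [← re_linePoint_sub_mul]
  have h2 : ∫⁻ x, ∫⁻ y, G (x, y) =
      ∫⁻ s : ℝ, ∫⁻ γ in Ioo (-Real.pi) Real.pi, ∫⁻ x, H s γ x := by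
    simp_rw [h1]
    calc ∫⁻ x, ∫⁻ γ in Ioo (-Real.pi) Real.pi, ∫⁻ s, H s γ x
        = ∫⁻ x, ∫⁻ s, ∫⁻ γ in Ioo (-Real.pi) Real.pi, H s γ x :=
          lintegral_congr fun x => lintegral_lintegral_swap
            (hHm.comp (f := fun q : ℝ × ℝ => (q.2, q.1, x)) (by fun_prop)).aemeasurable
      _ = ∫⁻ s, ∫⁻ x, ∫⁻ γ in Ioo (-Real.pi) Real.pi, H s γ x := by
          refine lintegral_lintegral_swap (Measurable.aemeasurable ?_)
          exact Measurable.lintegral_prod_right'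
            (hHm.comp (f := fun q : (ℂ × ℝ) × ℝ => (q.1.2, q.2, q.1.1)) (by fun_prop))
      _ = _ := lintegral_congr fun s => lintegral_lintegral_swap
            (hHm.comp (f := fun q : ℂ × ℝ => (s, q.2, q.1)) (by fun_prop)).aemeasurable
  rw [h2]
  refine lintegral_congr fun s => lintegral_congr fun γ => ?_
  have hnorm : ‖Complex.I * e γ‖ = 1 := by
    rw [norm_mul, Complex.norm_I, one_mul, he, Complex.norm_exp_ofReal_mul_I]
  -- The isometry x = z + i e^{iγ} w turns ρ into 2 Im w and sends the second point to position conj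
  -- w.
  rw [← lintegral_comp_add_mul (by simp only [hH, hρ, he]; fun_prop) (linePoint φ p s) hnorm,
    ← lintegral_const_mul _ (by fun_prop)]
  refine lintegral_congr fun w => ?_
  have hee : e γ * Complex.exp (-((γ : ℂ) * Complex.I)) = 1 := by
    rw [he, ← Complex.exp_add, add_neg_cancel, Complex.exp_zero]
  have hρw : ρ s γ (linePoint φ p s + Complex.I * e γ * w) = 2 * w.im := by
    have : (linePoint φ p s - (linePoint φ p s + Complex.I * e γ * w)) *
        Complex.exp (-((γ : ℂ) * Complex.I)) = -(Complex.I * w) := by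
      linear_combination (-(Complex.I * w)) * hee
    simp only [hρ, this]
    simp
  have hconj : conj w = w - 2 * w.im * Complex.I := by
    apply Complex.ext <;> simp; ring
  simp only [hH, hρw]
  congr 4
  rw [hconj]
  push_cast
  linear_combination (2 * e γ * (w.im : ℂ)) * Complex.I_mul_I

/-! ### The crossing integral in the new coordinates -/

lemma measurable_toIcoMod_two_pi : Measurable (toIcoMod Real.two_pi_pos 0) := by
  have : toIcoMod Real.two_pi_pos 0 = fun b : ℝ =>
      0 + Int.fract ((b - 0) / (2 * Real.pi)) * (2 * Real.pi) := by
    funext b; exact toIcoMod_eq_add_fract_mul Real.two_pi_pos 0 b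
  rw [this]; fun_prop

@[fun_prop]
lemma Measurable.clockwiseAngle {α : Type*} [MeasurableSpace α] {f g h : α → ℂ}
    (hf : Measurable f) (hg : Measurable g) (hh : Measurable h) :
    Measurable fun a => clockwiseAngle (f a) (g a) (h a) :=
  measurable_toIcoMod_two_pi.comp (Complex.measurable_arg.comp ((hf.sub hg).div (hh.sub hg)))

@[fun_prop]
lemma Measurable.linePoint {α : Type*} [MeasurableSpace α] {f g h : α → ℝ}
    (hf : Measurable f) (hg : Measurable g) (hh : Measurable h) :
    Measurable fun a => linePoint (f a) (g a) (h a) := by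
  unfold _root_.linePoint; fun_prop

@[fun_prop]
lemma Measurable.lineFrame {α : Type*} [MeasurableSpace α] {f g : α → ℝ} {x : α → ℂ}
    (hf : Measurable f) (hg : Measurable g) (hx : Measurable x) :
    Measurable fun a => lineFrame (f a) (g a) (x a) := by
  unfold _root_.lineFrame; fun_prop

@[fun_prop]
lemma Measurable.bisectorCoord {α : Type*} [MeasurableSpace α] {f g : α → ℝ} {x y : α → ℂ}
    (hf : Measurable f) (hg : Measurable g) (hx : Measurable x) (hy : Measurable y) :
    Measurable fun a => bisectorCoord (f a) (g a) (x a) (y a) := by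
  simp only [_root_.bisectorCoord, Complex.normSq_apply]; fun_prop

@[fun_prop]
lemma Measurable.bisectorPoint {α : Type*} [MeasurableSpace α] {f g : α → ℝ} {x y : α → ℂ}
    (hf : Measurable f) (hg : Measurable g) (hx : Measurable x) (hy : Measurable y) :
    Measurable fun a => bisectorPoint (f a) (g a) (x a) (y a) := by
  unfold _root_.bisectorPoint; fun_prop

/-- The pairs of points, the first one on the left, whose bisector crosses the line at a coordinate
in `I` and under an angle in `B`. -/
def markedPairs (φ p : ℝ) (I B : Set ℝ) : Set (ℂ × ℂ) :=
  {q | q.1.re < q.2.re ∧ (lineFrame φ p q.1).re ≠ (lineFrame φ p q.2).re ∧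
    bisectorCoord φ p q.1 q.2 ∈ I ∧
    clockwiseAngle q.1 (bisectorPoint φ p q.1 q.2) q.2 ∈ B}

lemma measurableSet_mem_markedPairs {α : Type*} [MeasurableSpace α] {f g : α → ℝ} {x y : α → ℂ}
    (hf : Measurable f) (hg : Measurable g) (hx : Measurable x) (hy : Measurable y)
    {I B : Set ℝ} (hI : MeasurableSet I) (hB : MeasurableSet B) :
    MeasurableSet {a | (x a, y a) ∈ markedPairs (f a) (g a) I B} := by
  refine (measurableSet_lt (f := fun a => (x a).re) (g := fun a => (y a).re)
    (by fun_prop) (by fun_prop)).inter (MeasurableSet.inter (MeasurableSet.compl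
    (measurableSet_eq_fun (f := fun a => (lineFrame (f a) (g a) (x a)).re)
      (g := fun a => (lineFrame (f a) (g a) (y a)).re) (by fun_prop) (by fun_prop)))
    (MeasurableSet.inter ?_ ?_))
  · exact (hf.bisectorCoord hg hx hy) hI
  · exact (hx.clockwiseAngle (hf.bisectorPoint hg hx hy) hy) hB

/-- The point at position `w` with respect to the point `z` and the direction `I * exp (γ I)`. -/
noncomputable def rotatedPoint (z : ℂ) (γ : ℝ) (w : ℂ) : ℂ :=
  z + Complex.I * Complex.exp ((γ : ℂ) * Complex.I) * w

lemma norm_I_mul_exp (γ : ℝ) : ‖Complex.I * Complex.exp ((γ : ℂ) * Complex.I)‖ = 1 := by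
  rw [norm_mul, Complex.norm_I, one_mul, Complex.norm_exp_ofReal_mul_I]

lemma dist_rotatedPoint (z : ℂ) (γ : ℝ) (w : ℂ) : dist z (rotatedPoint z γ w) = ‖w‖ := by
  rw [dist_comm, dist_eq_norm, rotatedPoint, add_sub_cancel_left, norm_mul, norm_I_mul_exp,
    one_mul]

lemma rotatedPoint_conj_sub (z : ℂ) (γ : ℝ) (w : ℂ) :
    rotatedPoint z γ (conj w) - rotatedPoint z γ w =
      (2 * w.im : ℝ) * Complex.exp ((γ : ℂ) * Complex.I) := by
  have hconj : conj w = w - 2 * w.im * Complex.I := by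
    apply Complex.ext <;> simp; ring
  rw [rotatedPoint, rotatedPoint, hconj]
  push_cast
  linear_combination (-(2 * Complex.exp ((γ : ℂ) * Complex.I) * (w.im : ℂ))) * Complex.I_mul_I

/-- The angle in `[0, 2π)` from `w` to its complex conjugate, measured clockwise. -/
noncomputable def conjAngle (w : ℂ) : ℝ :=
  toIcoMod Real.two_pi_pos 0 (Complex.arg (w / conj w))

@[fun_prop]
lemma measurable_conjAngle : Measurable conjAngle :=
  measurable_toIcoMod_two_pi.comp (Complex.measurable_arg.comp
    (measurable_id.div Complex.continuous_conj.measurable))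

lemma rotatedPoint_frame_re_ne {φ p γ : ℝ} (hγ : Real.cos (γ - φ) ≠ 0) (z : ℂ) {w : ℂ}
    (hw : 0 < w.im) : (lineFrame φ p (rotatedPoint z γ w)).re ≠
      (lineFrame φ p (rotatedPoint z γ (conj w))).re := by
  have h : lineFrame φ p (rotatedPoint z γ (conj w)) - lineFrame φ p (rotatedPoint z γ w) =
      (2 * w.im : ℝ) * Complex.exp (((γ - φ : ℝ) : ℂ) * Complex.I) := by
    have h1 := rotatedPoint_conj_sub z γ w
    have h2 : Complex.exp (((γ - φ : ℝ) : ℂ) * Complex.I) =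
        Complex.exp ((γ : ℂ) * Complex.I) * Complex.exp (-((φ : ℂ) * Complex.I)) := by
      rw [← Complex.exp_add]; push_cast; ring_nf
    rw [h2, ← mul_assoc, ← h1]
    simp only [lineFrame]; ring
  have h3 := congrArg Complex.re h
  rw [Complex.sub_re, Complex.re_ofReal_mul, Complex.exp_ofReal_mul_I_re] at h3
  intro h4
  rw [h4, sub_self] at h3
  exact (mul_ne_zero (by positivity) hγ) h3.symm

lemma bisectorCoord_rotatedPoint {φ p γ : ℝ} (hγ : Real.cos (γ - φ) ≠ 0) (s : ℝ) {w : ℂ}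
    (hw : 0 < w.im) : bisectorCoord φ p (rotatedPoint (linePoint φ p s) γ w)
      (rotatedPoint (linePoint φ p s) γ (conj w)) = s := by
  refine ((dist_linePoint_eq_iff (rotatedPoint_frame_re_ne hγ _ hw)).1 ?_).symm
  rw [dist_rotatedPoint, dist_rotatedPoint, RCLike.norm_conj]

/-- The three conditions separate: one on γ, one on s, one on w. This makes the mark independent of
position and direction. -/
lemma mem_markedPairs_rotatedPoint {φ p γ : ℝ} (hγ : Real.cos (γ - φ) ≠ 0) (s : ℝ) {w : ℂ}
    (hw : 0 < w.im) (I B : Set ℝ) :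
    (rotatedPoint (linePoint φ p s) γ w, rotatedPoint (linePoint φ p s) γ (conj w)) ∈
      markedPairs φ p I B ↔ 0 < Real.cos γ ∧ s ∈ I ∧ conjAngle w ∈ B := by
  have h1 : (rotatedPoint (linePoint φ p s) γ w).re <
      (rotatedPoint (linePoint φ p s) γ (conj w)).re ↔ 0 < Real.cos γ := by
    rw [← sub_pos, ← Complex.sub_re, rotatedPoint_conj_sub, Complex.re_ofReal_mul,
      Complex.exp_ofReal_mul_I_re]
    exact mul_pos_iff_of_pos_left (by positivity)
  have h2 : clockwiseAngle (rotatedPoint (linePoint φ p s) γ w) (linePoint φ p s)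
      (rotatedPoint (linePoint φ p s) γ (conj w)) = conjAngle w := by
    have hne : Complex.I * Complex.exp ((γ : ℂ) * Complex.I) ≠ 0 := by
      rw [← norm_ne_zero_iff, norm_I_mul_exp]; exact one_ne_zero
    rw [clockwiseAngle, conjAngle, rotatedPoint, rotatedPoint, add_sub_cancel_left,
      add_sub_cancel_left, mul_div_mul_left _ _ hne]
  simp only [markedPairs, mem_ofPred_eq, h1, bisectorPoint, bisectorCoord_rotatedPoint hγ s hw, h2,
    ne_eq, rotatedPoint_frame_re_ne hγ _ hw, not_false_eq_true, true_and]

/-- The directional factor of the intensity of the crossings. -/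
noncomputable def directionWeight (φ : ℝ) : ℝ≥0∞ :=
  ∫⁻ γ in Ioo (-Real.pi) Real.pi ∩ {γ | 0 < Real.cos γ}, ENNReal.ofReal |2 * Real.cos (γ - φ)|

/-- The factor of the mark in the intensity of the crossings. -/
noncomputable def markWeight (lam : ℝ) (B : Set ℝ) : ℝ≥0∞ :=
  ∫⁻ w : ℂ, ENNReal.ofReal (2 * w.im) *
    (conjAngle ⁻¹' B).indicator (fun w => ENNReal.ofReal (Real.exp (-(lam * (Real.pi * ‖w‖ ^ 2))))) w

/-- The exponential depends only on |w|, so the integral splits into a factor for each of s, γ and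
w. -/
lemma lintegral_markedPairs (lam φ p : ℝ) {I B : Set ℝ} (hI : MeasurableSet I)
    (hB : MeasurableSet B) :
    ∫⁻ x, ∫⁻ y, (markedPairs φ p I B).indicator (fun q => ENNReal.ofReal
      (Real.exp (-(lam * (Real.pi * dist (bisectorPoint φ p q.1 q.2) q.1 ^ 2))))) (x, y) =
      volume I * (directionWeight φ * markWeight lam B) := by
  have hT : MeasurableSet (markedPairs φ p I B) :=
    measurableSet_mem_markedPairs measurable_const measurable_const measurable_fst
      measurable_snd hI hB
  have hcos : MeasurableSet {γ : ℝ | 0 < Real.cos γ} :=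
    measurableSet_lt measurable_const Real.measurable_cos
  rw [lintegral_pair_eq_bisector φ p (Measurable.indicator (by fun_prop) hT)]
  have key : ∀ s : ℝ, ∀ γ : ℝ, Real.cos (γ - φ) ≠ 0 →
      (∫⁻ w : ℂ, ENNReal.ofReal (2 * w.im) * (markedPairs φ p I B).indicator (fun q =>
        ENNReal.ofReal (Real.exp (-(lam * (Real.pi *
          dist (bisectorPoint φ p q.1 q.2) q.1 ^ 2)))))
        (linePoint φ p s + Complex.I * Complex.exp ((γ : ℂ) * Complex.I) * w,
          linePoint φ p s + Complex.I * Complex.exp ((γ : ℂ) * Complex.I) * conj w)) =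
      I.indicator 1 s * ({γ | 0 < Real.cos γ}.indicator 1 γ * markWeight lam B) := by
    intro s γ hγ
    rw [← mul_assoc, markWeight, ← lintegral_const_mul _ (by
      refine Measurable.mul (by fun_prop) (Measurable.indicator (by fun_prop)
        (measurable_conjAngle hB)))]
    refine lintegral_congr fun w => ?_
    by_cases hw : 0 < w.im
    · have hmem := mem_markedPairs_rotatedPoint (p := p) hγ s hw I B
      have hd : dist (bisectorPoint φ p (rotatedPoint (linePoint φ p s) γ w)
          (rotatedPoint (linePoint φ p s) γ (conj w))) (rotatedPoint (linePoint φ p s) γ w) =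
          ‖w‖ := by
        rw [bisectorPoint, bisectorCoord_rotatedPoint hγ s hw, dist_rotatedPoint]
      rw [← rotatedPoint, ← rotatedPoint]
      by_cases h1 : 0 < Real.cos γ <;> by_cases h2 : s ∈ I <;> by_cases h3 : conjAngle w ∈ B <;>
        simp [indicator, hmem, h1, h2, h3, hd]
    -- The lower half-plane has Jacobian 0 after truncation by `ENNReal.ofReal`.
    · simp [ENNReal.ofReal_of_nonpos (show 2 * w.im ≤ 0 by linarith)]
  have hinner : ∀ s : ℝ, (∫⁻ γ in Ioo (-Real.pi) Real.pi, ENNReal.ofReal |2 * Real.cos (γ - φ)| *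
      ∫⁻ w : ℂ, ENNReal.ofReal (2 * w.im) * (markedPairs φ p I B).indicator (fun q =>
        ENNReal.ofReal (Real.exp (-(lam * (Real.pi *
          dist (bisectorPoint φ p q.1 q.2) q.1 ^ 2)))))
        (linePoint φ p s + Complex.I * Complex.exp ((γ : ℂ) * Complex.I) * w,
          linePoint φ p s + Complex.I * Complex.exp ((γ : ℂ) * Complex.I) * conj w)) =
      I.indicator 1 s * (directionWeight φ * markWeight lam B) := by
    intro s
    rw [directionWeight, inter_comm, ← Measure.restrict_restrict hcos,
      ← lintegral_indicator hcos, ← lintegral_mul_const _ (Measurable.indicator (by fun_prop) hcos),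
      ← lintegral_const_mul _ (Measurable.mul_const (Measurable.indicator (by fun_prop) hcos) _)]
    refine lintegral_congr_ae (ae_restrict_of_ae ?_)
    filter_upwards [ae_cos_sub_ne_zero φ] with γ hγ
    rw [key s γ hγ]
    by_cases h1 : 0 < Real.cos γ
    · simp only [indicator, mem_ofPred_eq, h1, if_true, Pi.one_apply]; ring
    · simp [indicator, h1]
  simp_rw [hinner]
  rw [lintegral_mul_const _ (measurable_one.indicator hI), lintegral_indicator_one hI]

/-! ### The law of the angle and the constants of the intensity -/

lemma conjAngle_polar {r γ : ℝ} (hr : 0 < r) (hγ : γ ∈ Ioo 0 Real.pi) :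
    conjAngle (r * Complex.exp ((γ : ℂ) * Complex.I)) = 2 * γ := by
  have h : (r * Complex.exp ((γ : ℂ) * Complex.I)) /
      conj (r * Complex.exp ((γ : ℂ) * Complex.I)) =
      Complex.exp (((2 * γ : ℝ) : ℂ) * Complex.I) := by
    have hr' : (r : ℂ) ≠ 0 := by exact_mod_cast hr.ne'
    rw [map_mul, Complex.conj_ofReal, ← Complex.exp_conj, map_mul, Complex.conj_ofReal,
      Complex.conj_I, mul_div_mul_left _ _ hr', ← Complex.exp_sub]
    push_cast; ring_nf
  -- The argument of e^{2iγ} is 2γ up to a multiple of 2π, and 2γ already lies in [0, 2π).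
  rw [conjAngle, h, Complex.arg_exp_mul_I, toIocMod, toIcoMod_sub_zsmul, toIcoMod_eq_self]
  exact ⟨by linarith [hγ.1], by linarith [hγ.2]⟩

/-- The radial factor of the intensity of the crossings. -/
noncomputable def radialWeight (lam : ℝ) : ℝ≥0∞ :=
  ∫⁻ r : ℝ, ENNReal.ofReal r *
    (ENNReal.ofReal (2 * r) * ENNReal.ofReal (Real.exp (-(lam * (Real.pi * r ^ 2)))))

lemma radialWeight_pos (lam : ℝ) : 0 < radialWeight lam := by
  rw [radialWeight, lintegral_pos_iff_support (by fun_prop)]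
  refine lt_of_lt_of_le (b := volume (Ioi (0 : ℝ))) (by simp) (measure_mono fun r hr => ?_)
  have hr' : 0 < r := hr
  simp [Real.exp_pos, hr']

lemma radialWeight_lt_top {lam : ℝ} (hlam : 0 < lam) : radialWeight lam < ∞ := by
  have h := (integrableOn_rpow_mul_exp_neg_mul_sq (b := lam * Real.pi) (by positivity)
    (s := 2) (by norm_num)).const_mul 2
  refine lt_of_le_of_lt ?_ h.lintegral_lt_top
  rw [radialWeight, ← lintegral_indicator measurableSet_Ioi]
  refine lintegral_mono fun r => ?_
  by_cases hr : 0 < r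
  · rw [indicator_of_mem (mem_Ioi.2 hr), ← ENNReal.ofReal_mul (by positivity),
      ← ENNReal.ofReal_mul hr.le, Real.rpow_two]
    refine ENNReal.ofReal_le_ofReal (le_of_eq ?_)
    ring_nf
  · simp [ENNReal.ofReal_of_nonpos (not_lt.1 hr)]

lemma angleLaw_apply {B : Set ℝ} (hB : MeasurableSet B) :
    angleLaw B = ∫⁻ t in Ioo 0 (2 * Real.pi), B.indicator 1 t *
      ENNReal.ofReal (1 / 4 * Real.sin (t / 2)) := by
  rw [angleLaw, withDensity_apply _ hB, ← lintegral_indicator hB]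
  refine lintegral_congr fun t => ?_
  by_cases h : t ∈ B <;> simp [h]

/-- Substitute t = 2γ; the factor 2 is the integral of the sine over (0, π). -/
lemma lintegral_sin_eq_angleLaw {B : Set ℝ} (hB : MeasurableSet B) :
    ∫⁻ γ in Ioo 0 Real.pi, B.indicator 1 (2 * γ) * ENNReal.ofReal (Real.sin γ) =
      2 * angleLaw B := by
  have hm : Measurable fun t : ℝ => B.indicator (1 : ℝ → ℝ≥0∞) t *
      ENNReal.ofReal (1 / 4 * Real.sin (t / 2)) :=
    (measurable_one.indicator hB).mul (by fun_prop)
  rw [angleLaw_apply hB, ← lintegral_indicator measurableSet_Ioo,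
    ← lintegral_indicator measurableSet_Ioo,
    lintegral_comp_affine (f := indicator _ _) (hm.indicator measurableSet_Ioo) two_ne_zero 0,
    ← lintegral_const_mul]
  · refine lintegral_congr fun γ => ?_
    have h1 : (2 * γ + 0 ∈ Ioo 0 (2 * Real.pi)) ↔ γ ∈ Ioo 0 Real.pi := by
      simp only [mem_Ioo]
      constructor <;> rintro ⟨h, h'⟩ <;> constructor <;> linarith
    by_cases h : γ ∈ Ioo 0 Real.pi
    · rw [indicator_of_mem h, indicator_of_mem (h1.2 h), add_zero,
        mul_div_cancel_left₀ _ (two_ne_zero (α := ℝ))]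
      have : ENNReal.ofReal (Real.sin γ) =
          2 * (ENNReal.ofReal |(2 : ℝ)| * ENNReal.ofReal (1 / 4 * Real.sin γ)) := by
        rw [← ENNReal.ofReal_mul (by positivity), ← ENNReal.ofReal_ofNat,
          ← ENNReal.ofReal_mul (by positivity), abs_of_pos two_pos]
        congr 1; ring
      rw [this]; ring
    · rw [indicator_of_notMem h, indicator_of_notMem (fun h' => h (h1.1 h'))]
      simp
  · refine Measurable.const_mul ?_ _
    exact (hm.indicator measurableSet_Ioo).comp (by fun_prop)

/-- In polar coordinates the Jacobian is 2 Im w = 2r · sin γ and the mark is 2γ, so radius and angle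
separate; the radial part collects r · 2r and the exponential. -/
lemma markWeight_eq (lam : ℝ) {B : Set ℝ} (hB : MeasurableSet B) :
    markWeight lam B = 2 * radialWeight lam * angleLaw B := by
  have hB2 : Measurable fun γ : ℝ => B.indicator (1 : ℝ → ℝ≥0∞) (2 * γ) :=
    (measurable_one.indicator hB).comp (by fun_prop)
  have hB3 : Measurable fun γ : ℝ => B.indicator (1 : ℝ → ℝ≥0∞) (2 * γ) *
      ENNReal.ofReal (Real.sin γ) := hB2.mul (by fun_prop)
  rw [markWeight, lintegral_eq_polar (f := fun w => ENNReal.ofReal (2 * w.im) *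
    (conjAngle ⁻¹' B).indicator (fun w => ENNReal.ofReal
      (Real.exp (-(lam * (Real.pi * ‖w‖ ^ 2))))) w) (Measurable.mul (by fun_prop)
    (Measurable.indicator (by fun_prop) (measurable_conjAngle hB))), mul_comm 2, mul_assoc,
    ← lintegral_sin_eq_angleLaw hB, radialWeight,
    ← lintegral_const_mul _ hB3,
    ← lintegral_indicator measurableSet_Ioo, ← lintegral_indicator measurableSet_Ioo]
  refine lintegral_congr fun γ => ?_
  have him : ∀ r : ℝ, ((r : ℂ) * Complex.exp ((γ : ℂ) * Complex.I)).im = r * Real.sin γ := by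
    intro r; rw [Complex.im_ofReal_mul, Complex.exp_ofReal_mul_I_im]
  by_cases h : γ ∈ Ioo 0 Real.pi
  · rw [indicator_of_mem h, indicator_of_mem (show γ ∈ Ioo (-Real.pi) Real.pi from
      ⟨by linarith [h.1, Real.pi_pos], h.2⟩), ← lintegral_mul_const _ (by fun_prop)]
    refine lintegral_congr fun r => ?_
    by_cases hr : 0 < r
    · have hn : ‖(r : ℂ) * Complex.exp ((γ : ℂ) * Complex.I)‖ = r := by
        rw [norm_mul, Complex.norm_exp_ofReal_mul_I, mul_one, Complex.norm_real,
          Real.norm_of_nonneg hr.le]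
      have hs : ENNReal.ofReal (2 * (r * Real.sin γ)) =
          ENNReal.ofReal (2 * r) * ENNReal.ofReal (Real.sin γ) := by
        rw [← mul_assoc, ENNReal.ofReal_mul (by positivity)]
      rw [him, hs]
      by_cases hm : 2 * γ ∈ B
      · rw [indicator_of_mem hm, indicator_of_mem (by rwa [mem_preimage, conjAngle_polar hr h]),
          hn, Pi.one_apply]
        ring
      · rw [indicator_of_notMem hm, indicator_of_notMem
          (by rwa [mem_preimage, conjAngle_polar hr h])]
        ring
    · simp [ENNReal.ofReal_of_nonpos (not_lt.1 hr)]
  · rw [indicator_of_notMem h]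
    by_cases h' : γ ∈ Ioo (-Real.pi) Real.pi
    · have hs : Real.sin γ ≤ 0 := by
        refine Real.sin_nonpos_of_nonpos_of_neg_pi_le ?_ h'.1.le
        by_contra! h0; exact h ⟨h0, h'.2⟩
      rw [indicator_of_mem h', lintegral_eq_zero_iff' (Measurable.aemeasurable ?_)]
      · refine Filter.Eventually.of_forall fun r => ?_
        by_cases hr : 0 < r
        · dsimp only [Pi.zero_apply]
          rw [him, ENNReal.ofReal_of_nonpos (show 2 * (r * Real.sin γ) ≤ 0 by
            have := mul_nonpos_of_nonneg_of_nonpos hr.le hs; linarith)]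
          simp
        · simp [ENNReal.ofReal_of_nonpos (not_lt.1 hr)]
      · refine Measurable.mul (by fun_prop) (Measurable.mul (by fun_prop) ?_)
        exact (Measurable.indicator (f := fun w : ℂ => ENNReal.ofReal
          (Real.exp (-(lam * (Real.pi * ‖w‖ ^ 2))))) (by fun_prop)
          (measurable_conjAngle hB)).comp (by fun_prop)
    · rw [indicator_of_notMem h']

lemma angleLaw_Ioo {a b : ℝ} (ha : 0 ≤ a) (hab : a ≤ b) (hb : b ≤ 2 * Real.pi) :
    angleLaw (Ioo a b) = ENNReal.ofReal ((Real.cos (a / 2) - Real.cos (b / 2)) / 2) := by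
  have hnn : ∀ t ∈ Ioo a b, 0 ≤ 1 / 4 * Real.sin (t / 2) := fun t ht => by
    have := Real.sin_nonneg_of_nonneg_of_le_pi (x := t / 2) (by linarith [ht.1])
      (by linarith [ht.2])
    positivity
  have hcont : Continuous fun t : ℝ => 1 / 4 * Real.sin (t / 2) := by fun_prop
  rw [angleLaw, withDensity_apply _ measurableSet_Ioo,
    Measure.restrict_restrict measurableSet_Ioo, inter_eq_left.2 (Ioo_subset_Ioo ha hb),
    ← ofReal_integral_eq_lintegral_ofReal
      ((hcont.integrableOn_Icc (a := a) (b := b)).mono_set Ioo_subset_Icc_self)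
      ((ae_restrict_iff' measurableSet_Ioo).2 (Filter.Eventually.of_forall hnn)),
    ← integral_Ioc_eq_integral_Ioo, ← intervalIntegral.integral_of_le hab]
  congr 1
  rw [intervalIntegral.integral_const_mul,
    intervalIntegral.integral_comp_div (fun x => Real.sin x) two_ne_zero, integral_sin]
  simp; ring

instance : IsProbabilityMeasure angleLaw := by
  constructor
  have h : angleLaw univ = angleLaw (Ioo 0 (2 * Real.pi)) := by
    rw [angleLaw, withDensity_apply _ MeasurableSet.univ, withDensity_apply _ measurableSet_Ioo,
      Measure.restrict_univ, Measure.restrict_restrict measurableSet_Ioo, inter_self]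
  rw [h, angleLaw_Ioo le_rfl (by positivity) le_rfl, mul_div_cancel_left₀ _ two_ne_zero]
  simp

lemma measurable_directionWeight : Measurable directionWeight := by
  unfold directionWeight
  refine Measurable.lintegral_prod_right' (f := fun q : ℝ × ℝ =>
    ENNReal.ofReal |2 * Real.cos (q.2 - q.1)|) ?_
  fun_prop

/-- The integrand vanishes only on a countable set of directions, while cos γ > 0 on a half-turn. -/
lemma directionWeight_pos (φ : ℝ) : 0 < directionWeight φ := by
  rw [directionWeight, setLIntegral_pos_iff (by fun_prop)]
  have hsub : Ioo (-(Real.pi / 2)) (Real.pi / 2) ⊆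
      Ioo (-Real.pi) Real.pi ∩ {γ | 0 < Real.cos γ} := fun γ hγ =>
    ⟨⟨by linarith [hγ.1, Real.pi_pos], by linarith [hγ.2, Real.pi_pos]⟩,
      Real.cos_pos_of_mem_Ioo hγ⟩
  refine lt_of_lt_of_le (b := volume (Ioo (-(Real.pi / 2)) (Real.pi / 2))) ?_
    (measure_mono_ae ?_)
  · simp [Real.pi_pos]
  · filter_upwards [ae_cos_sub_ne_zero φ] with γ hγ hmem
    exact ⟨by simpa using hγ, hsub hmem⟩

/-- A bound uniform in φ keeps the intensity finite for every law of the line. -/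
lemma directionWeight_le (φ : ℝ) : directionWeight φ ≤ 2 * ENNReal.ofReal (2 * Real.pi) := by
  calc directionWeight φ ≤ ∫⁻ γ in Ioo (-Real.pi) Real.pi ∩ {γ | 0 < Real.cos γ}, 2 := by
        refine lintegral_mono fun γ => ?_
        rw [← ENNReal.ofReal_ofNat 2, abs_mul, abs_of_pos two_pos]
        exact ENNReal.ofReal_le_ofReal (by linarith [Real.abs_cos_le_one (γ - φ)])
    _ ≤ 2 * ENNReal.ofReal (2 * Real.pi) := by
        rw [setLIntegral_const]
        gcongr
        refine (measure_mono inter_subset_left).trans ?_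
        rw [Real.volume_Ioo]
        exact ENNReal.ofReal_le_ofReal (by linarith)

/-! ### Sums over pairs and triples of points -/

lemma Measurable.lintegral_removalKernel {α : Type*} [MeasurableSpace α] {S : α → Config}
    (hS : Measurable S) {f : α → ℂ × Config → ℝ≥0∞} (hf : Measurable (Function.uncurry f)) :
    Measurable fun a => ∫⁻ q, f a q ∂removalKernel (S a) :=
  Measurable.lintegral_kernel_prod_right (κ := removalKernel.comap S hS) hf

/-- The sum of `f x y T` over the pairs of distinct points `x`, `y` of a locally finite
configuration `S`, where `T = S \ {x, y}`. -/
noncomputable def pairSum (f : ℂ × ℂ × Config → ℝ≥0∞) (S : Config) : ℝ≥0∞ :=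
  ∫⁻ q, ∫⁻ q', f (q.1, q'.1, q'.2) ∂removalKernel q.2 ∂removalKernel S

lemma measurable_pairSum {α : Type*} [MeasurableSpace α] {S : α → Config} (hS : Measurable S)
    {f : α → ℂ × ℂ × Config → ℝ≥0∞} (hf : Measurable (Function.uncurry f)) :
    Measurable fun a => pairSum (f a) (S a) := by
  refine hS.lintegral_removalKernel (Measurable.lintegral_removalKernel (by fun_prop) ?_)
  exact hf.comp (f := fun u : (α × ℂ × Config) × ℂ × Config => (u.1.1, u.1.2.1, u.2.1, u.2.2))
    (by fun_prop)

/-- The sum of `f x y z` over the triples of distinct points of a locally finite configuration. -/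
noncomputable def tripleSum (f : ℂ × ℂ × ℂ → ℝ≥0∞) (S : Config) : ℝ≥0∞ :=
  pairSum (fun a => ∫⁻ q, f (a.1, a.2.1, q.1) ∂removalKernel a.2.2) S

lemma measurable_tripleSum {α : Type*} [MeasurableSpace α] {S : α → Config} (hS : Measurable S)
    {f : α → ℂ × ℂ × ℂ → ℝ≥0∞} (hf : Measurable (Function.uncurry f)) :
    Measurable fun a => tripleSum (f a) (S a) := by
  refine measurable_pairSum hS (Measurable.lintegral_removalKernel (by fun_prop) ?_)
  exact hf.comp (f := fun u : (α × ℂ × ℂ × Config) × ℂ × Config =>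
    (u.1.1, u.1.2.1, u.1.2.2.1, u.2.1)) (by fun_prop)

open Classical in
lemma pairSum_eq_tsum {S : Config} (hS : IsLocallyFinite S) {f : ℂ × ℂ × Config → ℝ≥0∞}
    (hf : Measurable f) : pairSum f S = ∑' q : ℂ × ℂ,
      if q.1 ∈ S ∧ q.2 ∈ S \ {q.1} then f (q.1, q.2, ((S \ {q.1}) \ {q.2} : Set ℂ)) else 0 := by
  rw [pairSum, _root_.lintegral_removalKernel hS
    (Measurable.lintegral_removalKernel (by fun_prop) (by fun_prop)), ENNReal.tsum_prod']
  refine tsum_congr fun x => ?_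
  split_ifs with hx
  · rw [_root_.lintegral_removalKernel (hS.mono sdiff_subset) (by fun_prop)]
    refine tsum_congr fun y => ?_
    simp only [hx, true_and]
  · simp [hx]

/-- A vanishing sum of nonnegative terms has vanishing terms: this converts zero means into
statements about every pair. -/
lemma eq_zero_of_pairSum_eq_zero {S : Config} (hS : IsLocallyFinite S)
    {f : ℂ × ℂ × Config → ℝ≥0∞} (hf : Measurable f) (h : pairSum f S = 0) {x y : ℂ} (hx : x ∈ S)
    (hy : y ∈ S) (hxy : y ≠ x) : f (x, y, ((S \ {x}) \ {y} : Set ℂ)) = 0 := by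
  classical
  rw [pairSum_eq_tsum hS hf, ENNReal.tsum_eq_zero] at h
  have := h (x, y)
  rwa [if_pos ⟨hx, hy, hxy⟩] at this

lemma eq_zero_of_tripleSum_eq_zero {S : Config} (hS : IsLocallyFinite S) {f : ℂ × ℂ × ℂ → ℝ≥0∞}
    (hf : Measurable f) (h : tripleSum f S = 0) {x y z : ℂ} (hx : x ∈ S) (hy : y ∈ S)
    (hz : z ∈ S) (hxy : y ≠ x) (hzx : z ≠ x) (hzy : z ≠ y) : f (x, y, z) = 0 := by
  classical
  have h1 := eq_zero_of_pairSum_eq_zero hS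
    (Measurable.lintegral_removalKernel (by fun_prop) (by fun_prop)) h hx hy hxy
  rw [_root_.lintegral_removalKernel ((hS.mono sdiff_subset).mono sdiff_subset) (by fun_prop),
    ENNReal.tsum_eq_zero] at h1
  have := h1 z
  rwa [if_pos ⟨⟨hz, hzx⟩, hzy⟩] at this

namespace IsPoissonProcess

variable {Ω : Type*} [MeasurableSpace Ω] {P : Measure Ω} [IsProbabilityMeasure P] {lam : ℝ}
  {Φ : Ω → Set ℂ}

/-- Mecke's formula for the first point, then again for the second with the first one fixed. -/
lemma lintegral_pairSum (hΦ : IsPoissonProcess P lam Φ) (hlam : 0 ≤ lam)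
    {f : ℂ × ℂ × Config → ℝ≥0∞} (hf : Measurable f) :
    ∫⁻ S, pairSum f S ∂hΦ.law =
      ENNReal.ofReal lam ^ 2 * ∫⁻ x, ∫⁻ y, ∫⁻ S, f (x, y, S) ∂hΦ.law := by
  have hf2 : Measurable fun q : ℂ × Config => ∫⁻ q', f (q.1, q'.1, q'.2) ∂removalKernel q.2 :=
    Measurable.lintegral_removalKernel (by fun_prop) (by fun_prop)
  simp_rw [pairSum]
  rw [hΦ.lintegral_lintegral_removalKernel hlam hf2, sq, mul_assoc]
  congr 1
  have hx : ∀ x, ∫⁻ S, ∫⁻ q', f (x, q'.1, q'.2) ∂removalKernel S ∂hΦ.law =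
      ENNReal.ofReal lam * ∫⁻ y, ∫⁻ S, f (x, y, S) ∂hΦ.law := fun x =>
    hΦ.lintegral_lintegral_removalKernel hlam (f := fun q => f (x, q.1, q.2)) (by fun_prop)
  simp_rw [hx]
  rw [lintegral_const_mul' _ _ ENNReal.ofReal_ne_top]

lemma lintegral_tripleSum (hΦ : IsPoissonProcess P lam Φ) (hlam : 0 ≤ lam)
    {f : ℂ × ℂ × ℂ → ℝ≥0∞} (hf : Measurable f) :
    ∫⁻ S, tripleSum f S ∂hΦ.law =
      ENNReal.ofReal lam ^ 2 * ∫⁻ x, ∫⁻ y, ENNReal.ofReal lam * ∫⁻ z, f (x, y, z) := by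
  simp_rw [tripleSum]
  rw [hΦ.lintegral_pairSum hlam
    (Measurable.lintegral_removalKernel (by fun_prop) (by fun_prop))]
  congr 1
  refine lintegral_congr fun x => lintegral_congr fun y => ?_
  rw [hΦ.lintegral_lintegral_removalKernel hlam (f := fun q => f (x, y, q.1)) (by fun_prop)]
  simp

end IsPoissonProcess

/-! ### Almost sure general position, for a fixed line -/

lemma volume_re_eq (c : ℝ) : volume {z : ℂ | z.re = c} = 0 := by
  have h := Complex.volume_preserving_equiv_real_prod.measure_preimage
    (s := {c} ×ˢ (univ : Set ℝ))
    ((measurableSet_singleton c).prod MeasurableSet.univ).nullMeasurableSet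
  have hs : Complex.measurableEquivRealProd ⁻¹' ({c} ×ˢ (univ : Set ℝ)) = {z : ℂ | z.re = c} := by
    ext z; simp [Complex.measurableEquivRealProd_apply]
  rw [hs] at h
  rw [h, Measure.volume_eq_prod, Measure.prod_prod]
  simp

lemma volume_lineFrame_re_eq (φ p c : ℝ) : volume {z : ℂ | (lineFrame φ p z).re = c} = 0 := by
  have hm : MeasurableSet {z : ℂ | z.re = c} :=
    Complex.measurable_re (measurableSet_singleton c)
  have hm' : MeasurableSet {z : ℂ | (lineFrame φ p z).re = c} :=
    (show Measurable fun z : ℂ => (lineFrame φ p z).re by fun_prop) (measurableSet_singleton c)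
  have ha : ‖Complex.exp (-((φ : ℂ) * Complex.I))‖ = 1 := by
    rw [← neg_mul, ← Complex.ofReal_neg, Complex.norm_exp_ofReal_mul_I]
  rw [← volume_re_eq c, ← lintegral_indicator_one hm, ← lintegral_indicator_one hm',
    ← lintegral_comp_add_mul (measurable_one.indicator hm) (-((p : ℂ) * Complex.I)) ha]
  refine lintegral_congr fun z => ?_
  have : lineFrame φ p z =
      -((p : ℂ) * Complex.I) + Complex.exp (-((φ : ℂ) * Complex.I)) * z := by
    rw [lineFrame]; ring
  simp [indicator, this]

/-- The indicator of the pairs on a line perpendicular to the given line or to the first axis. -/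
noncomputable def alignedIndicator (t : ℝ × ℝ) : ℂ × ℂ × Config → ℝ≥0∞ :=
  {a | a.2.1.re = a.1.re ∨ (lineFrame t.1 t.2 a.2.1).re = (lineFrame t.1 t.2 a.1).re}.indicator 1

/-- The indicator of the triples of points that are equidistant from a point of the line. -/
noncomputable def equidistantIndicator (t : ℝ × ℝ) : ℂ × ℂ × ℂ → ℝ≥0∞ :=
  {a | dist a.2.2 (bisectorPoint t.1 t.2 a.1 a.2.1) =
    dist a.1 (bisectorPoint t.1 t.2 a.1 a.2.1)}.indicator 1

lemma alignedIndicator_eq_zero_iff {t : ℝ × ℝ} {x y : ℂ} {S : Config} :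
    alignedIndicator t (x, y, S) = 0 ↔
      ¬ (y.re = x.re ∨ (lineFrame t.1 t.2 y).re = (lineFrame t.1 t.2 x).re) := by
  simp [alignedIndicator, indicator]

lemma equidistantIndicator_eq_zero_iff {t : ℝ × ℝ} {x y z : ℂ} :
    equidistantIndicator t (x, y, z) = 0 ↔
      dist z (bisectorPoint t.1 t.2 x y) ≠ dist x (bisectorPoint t.1 t.2 x y) := by
  simp [equidistantIndicator, indicator]

lemma measurable_alignedIndicator : Measurable (Function.uncurry alignedIndicator) := by
  have h : MeasurableSet {b : (ℝ × ℝ) × ℂ × ℂ × Config | b.2.2.1.re = b.2.1.re ∨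
      (lineFrame b.1.1 b.1.2 b.2.2.1).re = (lineFrame b.1.1 b.1.2 b.2.1).re} :=
    (measurableSet_eq_fun (by fun_prop) (by fun_prop)).union
      (measurableSet_eq_fun (by fun_prop) (by fun_prop))
  exact measurable_one.indicator h

lemma measurable_equidistantIndicator : Measurable (Function.uncurry equidistantIndicator) := by
  have h : MeasurableSet {b : (ℝ × ℝ) × ℂ × ℂ × ℂ |
      dist b.2.2.2 (bisectorPoint b.1.1 b.1.2 b.2.1 b.2.2.1) =
      dist b.2.1 (bisectorPoint b.1.1 b.1.2 b.2.1 b.2.2.1)} :=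
    measurableSet_eq_fun (by fun_prop) (by fun_prop)
  exact measurable_one.indicator h

lemma inGeneralPosition_of_sums_eq_zero {S : Config} (hS : IsLocallyFinite S) {t : ℝ × ℝ}
    (h2 : pairSum (alignedIndicator t) S = 0) (h3 : tripleSum (equidistantIndicator t) S = 0) :
    InGeneralPosition S t.1 t.2 := by
  have hpair : ∀ X ∈ S, ∀ Y ∈ S, X ≠ Y → ¬ (Y.re = X.re ∨
      (lineFrame t.1 t.2 Y).re = (lineFrame t.1 t.2 X).re) := by
    intro X hX Y hY hne
    exact alignedIndicator_eq_zero_iff.1 (eq_zero_of_pairSum_eq_zero hS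
      measurable_alignedIndicator.of_uncurry_left h2 hX hY hne.symm)
  refine ⟨hS, fun X hX Y hY hne h => ?_, fun X hX Y hY hne h => ?_,
    fun X hX Y hY W hW hne hWX hWY h => ?_⟩
  · exact hpair X hX Y hY hne (Or.inl h.symm)
  · exact hpair X hX Y hY hne (Or.inr h.symm)
  · rw [dist_comm, dist_comm _ X] at h
    exact equidistantIndicator_eq_zero_iff.1 (eq_zero_of_tripleSum_eq_zero hS
      measurable_equidistantIndicator.of_uncurry_left h3 hX hY hW hne.symm hWX hWY) h

namespace IsPoissonProcess

variable {Ω : Type*} [MeasurableSpace Ω] {P : Measure Ω} [IsProbabilityMeasure P] {lam : ℝ}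
  {Φ : Ω → Set ℂ}

lemma lintegral_pairSum_aligned (hΦ : IsPoissonProcess P lam Φ) (hlam : 0 ≤ lam) (t : ℝ × ℝ) :
    ∫⁻ S, pairSum (alignedIndicator t) S ∂hΦ.law = 0 := by
  rw [hΦ.lintegral_pairSum hlam measurable_alignedIndicator.of_uncurry_left]
  refine mul_eq_zero_of_right _ ?_
  rw [← lintegral_zero (α := ℂ) (μ := volume)]
  refine lintegral_congr fun x => ?_
  have hE : volume ({y : ℂ | y.re = x.re} ∪
      {y : ℂ | (lineFrame t.1 t.2 y).re = (lineFrame t.1 t.2 x).re}) = 0 :=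
    measure_union_null (volume_re_eq _) (volume_lineFrame_re_eq _ _ _)
  rw [← lintegral_zero (α := ℂ) (μ := volume)]
  refine lintegral_congr_ae ?_
  filter_upwards [measure_eq_zero_iff_ae_notMem.1 hE] with y hy
  rw [← lintegral_zero (μ := hΦ.law)]
  exact lintegral_congr fun S => alignedIndicator_eq_zero_iff.2 hy

lemma lintegral_tripleSum_equidistant (hΦ : IsPoissonProcess P lam Φ) (hlam : 0 ≤ lam)
    (t : ℝ × ℝ) : ∫⁻ S, tripleSum (equidistantIndicator t) S ∂hΦ.law = 0 := by
  rw [hΦ.lintegral_tripleSum hlam measurable_equidistantIndicator.of_uncurry_left]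
  refine mul_eq_zero_of_right _ ?_
  rw [← lintegral_zero (α := ℂ) (μ := volume)]
  refine lintegral_congr fun x => ?_
  rw [← lintegral_zero (α := ℂ) (μ := volume)]
  refine lintegral_congr fun y => mul_eq_zero_of_right _ ?_
  rw [← lintegral_zero (α := ℂ) (μ := volume)]
  refine lintegral_congr_ae ?_
  -- For fixed x and y the third point is confined to a circle, null whatever its centre, including
  -- the default centre used when the bisector is parallel to the line.
  filter_upwards [measure_eq_zero_iff_ae_notMem.1 (Measure.addHaar_sphere volume
    (bisectorPoint t.1 t.2 x y) (dist x (bisectorPoint t.1 t.2 x y)))] with z hz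
  exact equidistantIndicator_eq_zero_iff.2 hz

end IsPoissonProcess

/-! ### The mean number of marked crossings -/

open Classical in
/-- The number of points of a configuration that are nearer than `x` to the point of the line that
is equidistant from `x` and `y`. -/
noncomputable def nearerCount (t : ℝ × ℝ) (a : ℂ × ℂ × Config) : ℝ≥0∞ :=
  ∫⁻ q, if dist q.1 (bisectorPoint t.1 t.2 a.1 a.2.1) < dist a.1 (bisectorPoint t.1 t.2 a.1 a.2.1)
    then 1 else 0 ∂removalKernel a.2.2

/-- The disc moves with the pair and the line, so its emptiness is not a fixed void event; as a
kernel integral, the count is jointly measurable in line, pair and configuration. -/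
lemma measurable_nearerCount : Measurable (Function.uncurry nearerCount) := by
  classical
  refine Measurable.lintegral_removalKernel (S := fun b : (ℝ × ℝ) × ℂ × ℂ × Config => b.2.2.2)
    (by fun_prop) ?_
  refine Measurable.ite ?_ measurable_const measurable_const
  exact measurableSet_lt (f := fun b : ((ℝ × ℝ) × ℂ × ℂ × Config) × ℂ × Config =>
    dist b.2.1 (bisectorPoint b.1.1.1 b.1.1.2 b.1.2.1 b.1.2.2.1))
    (g := fun b => dist b.1.2.1 (bisectorPoint b.1.1.1 b.1.1.2 b.1.2.1 b.1.2.2.1))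
    (by fun_prop) (by fun_prop)

lemma nearerCount_eq_zero_iff {t : ℝ × ℝ} {x y : ℂ} {S : Config} (hS : IsLocallyFinite S) :
    nearerCount t (x, y, S) = 0 ↔ ∀ W ∈ S,
      dist (bisectorPoint t.1 t.2 x y) x ≤ dist (bisectorPoint t.1 t.2 x y) W := by
  classical
  rw [nearerCount, lintegral_removalKernel hS (Measurable.ite (measurableSet_lt (by fun_prop)
    (by fun_prop)) measurable_const measurable_const), ENNReal.tsum_eq_zero]
  refine forall_congr' fun W => ?_
  by_cases hW : W ∈ S
  · simp [hW, dist_comm]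
  · simp [hW]

/-- The indicator of the pairs that produce a marked crossing, with respect to the configuration of
the other points. -/
noncomputable def crossingIndicator (I B : Set ℝ) (t : ℝ × ℝ) : ℂ × ℂ × Config → ℝ≥0∞ :=
  {a | (a.1, a.2.1) ∈ markedPairs t.1 t.2 I B ∧ nearerCount t a = 0}.indicator 1

lemma crossingIndicator_of_mem {I B : Set ℝ} {t : ℝ × ℝ} {x y : ℂ} {S : Config}
    (h : (x, y) ∈ markedPairs t.1 t.2 I B ∧ nearerCount t (x, y, S) = 0) :
    crossingIndicator I B t (x, y, S) = 1 := by
  simp [crossingIndicator, indicator, h]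

lemma crossingIndicator_of_notMem {I B : Set ℝ} {t : ℝ × ℝ} {x y : ℂ} {S : Config}
    (h : ¬ ((x, y) ∈ markedPairs t.1 t.2 I B ∧ nearerCount t (x, y, S) = 0)) :
    crossingIndicator I B t (x, y, S) = 0 := by
  simp [crossingIndicator, indicator, h]

lemma measurable_crossingIndicator {I B : Set ℝ} (hI : MeasurableSet I) (hB : MeasurableSet B) :
    Measurable (Function.uncurry (crossingIndicator I B)) := by
  have h : MeasurableSet {b : (ℝ × ℝ) × ℂ × ℂ × Config |
      (b.2.1, b.2.2.1) ∈ markedPairs b.1.1 b.1.2 I B ∧ nearerCount b.1 b.2 = 0} :=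
    (measurableSet_mem_markedPairs (by fun_prop) (by fun_prop) (by fun_prop) (by fun_prop)
      hI hB).inter (measurable_nearerCount (measurableSet_singleton 0))
  exact measurable_one.indicator h

/-- `X` and `Y` are both at the minimal distance, so minimality need only be tested on the other
nuclei, as Mecke's formula requires. -/
lemma InGeneralPosition.pointCount_eq_pairSum {S : Config} {t : ℝ × ℝ}
    (h : InGeneralPosition S t.1 t.2) {I B : Set ℝ} (hI : MeasurableSet I)
    (hB : MeasurableSet B) : pointCount (markedCrossings S t.1 t.2) (I ×ˢ B) =
      pairSum (crossingIndicator I B t) S := by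
  classical
  rw [h.pointCount_markedCrossings, encard_eq_tsum, pairSum_eq_tsum h.locallyFinite
    (measurable_crossingIndicator hI hB).of_uncurry_left]
  refine tsum_congr fun q => ?_
  obtain ⟨X, Y⟩ := q
  dsimp only
  have hiff : (X, Y) ∈ {q : ℂ × ℂ | IsCrossingPair S t.1 t.2 q.1 q.2 ∧
      bisectorCoord t.1 t.2 q.1 q.2 ∈ I ∧
      clockwiseAngle q.1 (bisectorPoint t.1 t.2 q.1 q.2) q.2 ∈ B} ↔
      (X ∈ S ∧ Y ∈ S \ {X}) ∧ (X, Y) ∈ markedPairs t.1 t.2 I B ∧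
        nearerCount t (X, Y, ((S \ {X}) \ {Y} : Set ℂ)) = 0 := by
    rw [nearerCount_eq_zero_iff ((h.locallyFinite.mono sdiff_subset).mono sdiff_subset)]
    constructor
    · rintro ⟨⟨hX, hY, hlt, hmin⟩, hs, hθ⟩
      have hne : X ≠ Y := fun h' => hlt.ne (by rw [h'])
      exact ⟨⟨hX, hY, hne.symm⟩, ⟨hlt, h.frame_ne X hX Y hY hne, hs, hθ⟩,
        fun W hW => hmin W hW.1.1⟩
    · rintro ⟨⟨hX, hY, hne⟩, ⟨hlt, hfr, hs, hθ⟩, hmin⟩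
      refine ⟨⟨hX, hY, hlt, fun W hW => ?_⟩, hs, hθ⟩
      by_cases h1 : W = X
      · rw [h1]
      · by_cases h2 : W = Y
        · rw [h2]; exact ((dist_linePoint_eq_iff hfr).2 rfl).le
        · exact hmin W ⟨⟨hW, h1⟩, h2⟩
  by_cases hc : X ∈ S ∧ Y ∈ S \ {X}
  · rw [if_pos hc]
    by_cases hm : (X, Y) ∈ markedPairs t.1 t.2 I B ∧
        nearerCount t (X, Y, ((S \ {X}) \ {Y} : Set ℂ)) = 0
    · rw [if_pos (hiff.2 ⟨hc, hm⟩), crossingIndicator_of_mem hm]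
    · rw [if_neg fun h' => hm (hiff.1 h').2, crossingIndicator_of_notMem hm]
  · rw [if_neg hc, if_neg fun h' => hc (hiff.1 h').1]

namespace IsPoissonProcess

variable {Ω : Type*} [MeasurableSpace Ω] {P : Measure Ω} [IsProbabilityMeasure P] {lam : ℝ}
  {Φ : Ω → Set ℂ}

lemma ae_law_isLocallyFinite (hΦ : IsPoissonProcess P lam Φ) (hlam : 0 ≤ lam) :
    ∀ᵐ S ∂hΦ.law, IsLocallyFinite S := by
  have hm : MeasurableSet {S : Config | IsLocallyFinite S} := by
    have : {S : Config | IsLocallyFinite S} =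
        ⋂ k, {S : Config | pointCount S (annulus k) < ∞} := by
      ext S
      simp [IsLocallyFinite, pointCount]
    rw [this]
    exact MeasurableSet.iInter fun k => measurableSet_lt
      (measurable_pointCount (measurableSet_annulus k)) measurable_const
  rw [law, ae_map_iff hΦ.measurable_process.aemeasurable hm]
  exact hΦ.ae_isLocallyFinite hlam

/-- For a fixed pair this is the probability that an open disc of area πR² is void. -/
lemma lintegral_crossingIndicator (hΦ : IsPoissonProcess P lam Φ) (hlam : 0 ≤ lam) {I B : Set ℝ}
    (t : ℝ × ℝ) (x y : ℂ) : ∫⁻ S, crossingIndicator I B t (x, y, S) ∂hΦ.law =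
      (markedPairs t.1 t.2 I B).indicator (fun q => ENNReal.ofReal
        (Real.exp (-(lam * (Real.pi * dist (bisectorPoint t.1 t.2 q.1 q.2) q.1 ^ 2))))) (x, y) := by
  by_cases hxy : (x, y) ∈ markedPairs t.1 t.2 I B
  · rw [indicator_of_mem hxy]
    set z := bisectorPoint t.1 t.2 x y with hz
    have hae : (fun S => crossingIndicator I B t (x, y, S)) =ᵐ[hΦ.law]
        (voidEvent (Metric.ball z (dist z x))).indicator 1 := by
      filter_upwards [hΦ.ae_law_isLocallyFinite hlam] with S hS
      have hiff : nearerCount t (x, y, S) = 0 ↔ S ∈ voidEvent (Metric.ball z (dist z x)) := by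
        rw [nearerCount_eq_zero_iff hS, voidEvent, mem_ofPred_eq, Set.disjoint_left]
        refine forall₂_congr fun W _ => ?_
        rw [Metric.mem_ball, not_lt, dist_comm W]
      by_cases h : nearerCount t (x, y, S) = 0
      · rw [indicator_of_mem (hiff.1 h), crossingIndicator_of_mem ⟨hxy, h⟩, Pi.one_apply]
      · rw [indicator_of_notMem fun h' => h (hiff.2 h'),
          crossingIndicator_of_notMem fun h' => h h'.2]
    have hvol : volume (Metric.ball z (dist z x)) =
        ENNReal.ofReal (Real.pi * dist z x ^ 2) := by
      rw [Complex.volume_ball, mul_comm, ENNReal.ofReal_mul Real.pi_pos.le,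
        ENNReal.ofReal_pow dist_nonneg, ← NNReal.coe_real_pi, ENNReal.ofReal_coe_nnreal]
    have hvoid := measurableSet_voidEvent (C := Metric.ball z (dist z x)) measurableSet_ball
    rw [lintegral_congr_ae hae, lintegral_indicator_one hvoid, law,
      Measure.map_apply hΦ.measurable_process hvoid]
    have := hΦ.prob_void (C := Metric.ball z (dist z x)) measurableSet_ball
      (by rw [hvol]; exact ENNReal.ofReal_ne_top)
    rw [hvol, ENNReal.toReal_ofReal (by positivity)] at this
    rw [← this]
    congr 1
    ext ω
    exact pointCount_eq_zero.symm
  · rw [indicator_of_notMem hxy]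
    rw [← lintegral_zero (μ := hΦ.law)]
    exact lintegral_congr fun S => crossingIndicator_of_notMem fun h => hxy h.1

lemma lintegral_pairSum_crossing (hΦ : IsPoissonProcess P lam Φ) (hlam : 0 ≤ lam) {I B : Set ℝ}
    (hI : MeasurableSet I) (hB : MeasurableSet B) (t : ℝ × ℝ) :
    ∫⁻ S, pairSum (crossingIndicator I B t) S ∂hΦ.law = ENNReal.ofReal lam ^ 2 *
      (volume I * (directionWeight t.1 * (2 * radialWeight lam * angleLaw B))) := by
  rw [hΦ.lintegral_pairSum hlam (measurable_crossingIndicator hI hB).of_uncurry_left]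
  simp_rw [hΦ.lintegral_crossingIndicator hlam]
  rw [lintegral_markedPairs lam t.1 t.2 hI hB, markWeight_eq lam hB]

variable {φ p : Ω → ℝ}

/-- The law of a Poisson process and an independent line. -/
lemma map_process_line (hΦ : IsPoissonProcess P lam Φ) (hφ : Measurable φ) (hp : Measurable p)
    (hindep : Indep (MeasurableSpace.comap Φ configSigma)
      (MeasurableSpace.comap (fun ω => (φ ω, p ω)) inferInstance) P) :
    P.map (fun ω => (Φ ω, (φ ω, p ω))) = hΦ.law.prod (P.map fun ω => (φ ω, p ω)) := by
  have h : IndepFun Φ (fun ω => (φ ω, p ω)) P := (IndepFun_iff_Indep _ _ _).2 hindep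
  exact (indepFun_iff_map_prod_eq_prod_map_map hΦ.measurable_process.aemeasurable
    (hφ.prodMk hp).aemeasurable).1 h

lemma lintegral_process_line (hΦ : IsPoissonProcess P lam Φ) (hφ : Measurable φ)
    (hp : Measurable p)
    (hindep : Indep (MeasurableSpace.comap Φ configSigma)
      (MeasurableSpace.comap (fun ω => (φ ω, p ω)) inferInstance) P)
    {F : Config × (ℝ × ℝ) → ℝ≥0∞} (hF : Measurable F) :
    ∫⁻ ω, F (Φ ω, (φ ω, p ω)) ∂P = ∫⁻ ω, ∫⁻ S, F (S, (φ ω, p ω)) ∂hΦ.law ∂P := by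
  rw [← lintegral_map hF (hΦ.measurable_process.prodMk (hφ.prodMk hp)),
    hΦ.map_process_line hφ hp hindep, lintegral_prod_symm _ hF.aemeasurable,
    lintegral_map hF.lintegral_prod_left' (hφ.prodMk hp)]

/-- The mean numbers of degenerate pairs and triples vanish for each fixed line, hence for an
independent random one by Fubini. -/
lemma ae_inGeneralPosition (hΦ : IsPoissonProcess P lam Φ) (hlam : 0 ≤ lam) (hφ : Measurable φ)
    (hp : Measurable p)
    (hindep : Indep (MeasurableSpace.comap Φ configSigma)
      (MeasurableSpace.comap (fun ω => (φ ω, p ω)) inferInstance) P) :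
    ∀ᵐ ω ∂P, InGeneralPosition (Φ ω) (φ ω) (p ω) := by
  have hline : Measurable fun ω => (Φ ω, (φ ω, p ω)) :=
    hΦ.measurable_process.prodMk (hφ.prodMk hp)
  have m2 : Measurable fun a : Config × (ℝ × ℝ) => pairSum (alignedIndicator a.2) a.1 :=
    measurable_pairSum measurable_fst (measurable_alignedIndicator.comp
      (f := fun u : (Config × (ℝ × ℝ)) × ℂ × ℂ × Config => (u.1.2, u.2)) (by fun_prop))
  have m3 : Measurable fun a : Config × (ℝ × ℝ) => tripleSum (equidistantIndicator a.2) a.1 :=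
    measurable_tripleSum measurable_fst (measurable_equidistantIndicator.comp
      (f := fun u : (Config × (ℝ × ℝ)) × ℂ × ℂ × ℂ => (u.1.2, u.2)) (by fun_prop))
  have h2 := hΦ.lintegral_process_line hφ hp hindep m2
  have h3 := hΦ.lintegral_process_line hφ hp hindep m3
  simp only [hΦ.lintegral_pairSum_aligned hlam, hΦ.lintegral_tripleSum_equidistant hlam,
    lintegral_zero] at h2 h3
  replace h2 := (lintegral_eq_zero_iff (m2.comp hline)).1 h2
  replace h3 := (lintegral_eq_zero_iff (m3.comp hline)).1 h3
  filter_upwards [hΦ.ae_isLocallyFinite hlam, h2, h3] with ω hω h2 h3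
  exact inGeneralPosition_of_sums_eq_zero (t := (φ ω, p ω)) hω h2 h3

/-- The intensity of the crossings. -/
lemma lintegral_pairSum_process_line (hΦ : IsPoissonProcess P lam Φ) (hlam : 0 ≤ lam)
    (hφ : Measurable φ) (hp : Measurable p)
    (hindep : Indep (MeasurableSpace.comap Φ configSigma)
      (MeasurableSpace.comap (fun ω => (φ ω, p ω)) inferInstance) P)
    {I B : Set ℝ} (hI : MeasurableSet I) (hB : MeasurableSet B) :
    ∫⁻ ω, pairSum (crossingIndicator I B (φ ω, p ω)) (Φ ω) ∂P =
      (ENNReal.ofReal lam ^ 2 * (2 * radialWeight lam) * ∫⁻ ω, directionWeight (φ ω) ∂P) *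
        volume I * angleLaw B := by
  have m : Measurable fun a : Config × (ℝ × ℝ) => pairSum (crossingIndicator I B a.2) a.1 :=
    measurable_pairSum measurable_fst ((measurable_crossingIndicator hI hB).comp
      (f := fun u : (Config × (ℝ × ℝ)) × ℂ × ℂ × Config => (u.1.2, u.2)) (by fun_prop))
  have hdir : Measurable fun ω => directionWeight (φ ω) := measurable_directionWeight.comp hφ
  rw [hΦ.lintegral_process_line hφ hp hindep m]
  simp only [hΦ.lintegral_pairSum_crossing hlam hI hB]
  rw [lintegral_const_mul _ ((hdir.mul_const _).const_mul _),
    lintegral_const_mul _ (hdir.mul_const _), lintegral_mul_const _ hdir]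
  ring

end IsPoissonProcess

/-! ### Uniqueness of the Palm distribution and conclusion -/

lemma HasPalmMarkDistribution.unique {Ω : Type*} [MeasurableSpace Ω] {P : Measure Ω}
    {M : Ω → Set (ℝ × ℝ)} {ν ν' : Measure ℝ} (h : HasPalmMarkDistribution P M ν)
    (h' : HasPalmMarkDistribution P M ν') {B : Set ℝ} (hB : MeasurableSet B) : ν B = ν' B := by
  have := (h.mean_count _ B (measurableSet_Icc (a := (0 : ℝ)) (b := 1)) hB).symm.trans
    (h'.mean_count _ B measurableSet_Icc hB)
  simpa [ENNReal.mul_right_inj h.intensity_pos.ne' h.intensity_lt_top.ne] using this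

theorem mainTheorem1 {Ω : Type*} [MeasurableSpace Ω] (P : Measure Ω) [IsProbabilityMeasure P]
    (lam : ℝ) (hlam : 0 < lam) (Φ : Ω → Set ℂ) (hΦ : IsPoissonProcess P lam Φ)
    (φ p : Ω → ℝ) (hφ : Measurable φ) (hp : Measurable p)
    (hindep : Indep (MeasurableSpace.comap Φ configSigma)
      (MeasurableSpace.comap (fun ω => (φ ω, p ω)) inferInstance) P) :
    (∀ᵐ ω ∂P, ∀ s ∈ crossings (Φ ω) (φ ω) (p ω),
      ∃! q : ℂ × ℂ, IsOrderedNeighbours (Φ ω) (linePoint (φ ω) (p ω) s) q.1 q.2) ∧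
    HasPalmMarkDistribution P (fun ω => markedCrossings (Φ ω) (φ ω) (p ω)) angleLaw ∧
    (∀ ν : Measure ℝ,
      HasPalmMarkDistribution P (fun ω => markedCrossings (Φ ω) (φ ω) (p ω)) ν →
      ∀ t ∈ Ioo (0 : ℝ) Real.pi,
        ν (Ioo t Real.pi) = ENNReal.ofReal (1 / 2 * Real.cos (t / 2))) := by
  have hgp := hΦ.ae_inGeneralPosition hlam.le hφ hp hindep
  set c : ℝ≥0∞ := ENNReal.ofReal lam ^ 2 * (2 * radialWeight lam) *
    ∫⁻ ω, directionWeight (φ ω) ∂P with hc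
  have hcount : ∀ I B : Set ℝ, MeasurableSet I → MeasurableSet B →
      (fun ω => pointCount (markedCrossings (Φ ω) (φ ω) (p ω)) (I ×ˢ B)) =ᵐ[P]
        fun ω => pairSum (crossingIndicator I B (φ ω, p ω)) (Φ ω) := by
    intro I B hI hB
    filter_upwards [hgp] with ω hω
    exact InGeneralPosition.pointCount_eq_pairSum (t := (φ ω, p ω)) hω hI hB
  have hmean : ∀ I B : Set ℝ, MeasurableSet I → MeasurableSet B →
      ∫⁻ ω, pointCount (markedCrossings (Φ ω) (φ ω) (p ω)) (I ×ˢ B) ∂P =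
        c * volume I * angleLaw B := by
    intro I B hI hB
    rw [lintegral_congr_ae (hcount I B hI hB),
      hΦ.lintegral_pairSum_process_line hlam.le hφ hp hindep hI hB]
  -- Taking I = [0, 1] and all marks identifies the constant, since `angleLaw` has mass 1.
  have hint : markedIntensity P (fun ω => markedCrossings (Φ ω) (φ ω) (p ω)) = c := by
    rw [markedIntensity, hmean _ _ measurableSet_Icc MeasurableSet.univ]
    simp
  have hdir_pos : 0 < ∫⁻ ω, directionWeight (φ ω) ∂P := by
    refine (lintegral_pos_iff_support (measurable_directionWeight.comp hφ)).2 ?_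
    have : Function.support (directionWeight ∘ φ) = univ :=
      Function.support_eq_univ fun ω => (directionWeight_pos (φ ω)).ne'
    rw [this, measure_univ]
    exact one_pos
  have hdir_lt : ∫⁻ ω, directionWeight (φ ω) ∂P < ∞ := by
    refine (lintegral_mono fun ω => directionWeight_le (φ ω)).trans_lt ?_
    rw [lintegral_const, measure_univ, mul_one]
    exact ENNReal.mul_lt_top ENNReal.ofNat_lt_top ENNReal.ofReal_lt_top
  have hpalm : HasPalmMarkDistribution P (fun ω => markedCrossings (Φ ω) (φ ω) (p ω))
      angleLaw := by
    refine ⟨fun I B hI hB => ?_, ?_, ?_, inferInstance, fun I B hI hB => ?_⟩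
    · have hm : Measurable fun ω => pairSum (crossingIndicator I B (φ ω, p ω)) (Φ ω) :=
        measurable_pairSum hΦ.measurable_process ((measurable_crossingIndicator hI hB).comp
          (f := fun u : Ω × ℂ × ℂ × Config => ((φ u.1, p u.1), u.2)) (by fun_prop))
      exact hm.aemeasurable.congr (hcount I B hI hB).symm
    · rw [hint]
      exact pos_iff_ne_zero.2 (mul_ne_zero (mul_ne_zero (pow_ne_zero _ (by simpa using hlam))
        (mul_ne_zero two_ne_zero (radialWeight_pos lam).ne')) hdir_pos.ne')
    · rw [hint]
      exact ENNReal.mul_lt_top (ENNReal.mul_lt_top (ENNReal.pow_lt_top ENNReal.ofReal_lt_top)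
        (ENNReal.mul_lt_top ENNReal.ofNat_lt_top (radialWeight_lt_top hlam))) hdir_lt
    · rw [hint, hmean I B hI hB]
  refine ⟨?_, hpalm, fun ν hν t ht => ?_⟩
  · filter_upwards [hgp] with ω hω s hs
    exact hω.existsUnique_orderedNeighbours hs
  · rw [hν.unique hpalm measurableSet_Ioo,
      angleLaw_Ioo ht.1.le ht.2.le (by linarith [Real.pi_pos]), Real.cos_pi_div_two]
    congr 1
    ring
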